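/- Let $\mathfrak g$ be a finite-dimensional complex Lie algebra with a nondegenerate invariant symmetric bilinear form $\kappa$. Let $S_+$, $S_-$ be the Weyl spinor spaces of $\mathrm{Spin}(4)$ with bases $\alpha_1,\alpha_2$ and $\alpha_1^\vee,\alpha_2^\vee$, let $W$ be a four-dimensional complex vector space with basis $e_1,e_2,f_1,f_2$, and identify $\Lambda^4W^*=\mathbb C$. Use the complex coordinates $z_1,z_2$ on $\mathbb R^4=\mathbb C^2$ and the isomorphism $S_+\otimes S_-\cong\mathbb C^4$ given by $\alpha_1\otimes\alpha_i^\vee\mapsto\partial_{\bar z_i}$, $\alpha_2\otimes\alpha_1^\vee\mapsto-\partial_{z_2}$, $\alpha_2\otimes\alpha_2^\vee\mapsto\partial_{z_1}$. The classical BV complex of (complexified) self-dual $\mathcal N=4$ super Yang--Mills theory on $\mathbb R^4$ is the $\mathbb Z\times\mathbb Z/2$-graded complex with the rows $$\Omega^0(\mathfrak g)\xrightarrow{d}\Omega^1(\mathfrak g)\xrightarrow{d_+}\Omega^2_+(\mathfrak g)\quad\text{(degrees }-1,0,1),$$ $$\Omega^0(S_-\otimes W^*\otimes\mathfrak g)\xrightarrow{\not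 d}\Omega^0(S_+\otimes W^*\otimes\mathfrak g),\qquad \Omega^0(\Lambda^2W^*\otimes\mathfrak g)\xrightarrow{\Delta}\Omega^0(\Lambda^2W^*\otimes\mathfrak g),$$ $$\Omega^0(S_+\otimes\Lambda^3W^*\otimes\mathfrak g)\xrightarrow{\not d}\Omega^0(S_-\otimes\Lambda^3W^*\otimes\mathfrak g)\quad\text{(degrees }0,1),$$ $$\Omega^2_+(\Lambda^4W^*\otimes\mathfrak g)\xrightarrow{d}\Omega^3(\Lambda^4W^*\otimes\mathfrak g)\xrightarrow{d}\Omega^4(\Lambda^4W^*\otimes\mathfrak g)\quad\text{(degrees }0,1,2),$$ where the row with $\Lambda^kW^*$ has fermionic degree $k$ mod $2$. Its $(-1)$-shifted symplectic pairing is the antisymmetric density-valued pairing that combines the wedge products of forms and of $\Lambda^\bullet W^*$, the area forms of $S_\pm$, and $\kappa$. A supertranslation $\alpha\otimes w\in S_+\otimes W$ acts by operators from the row $\Lambda^kW^*$ to the row $\Lambda^{k-1}W^*$: contraction $i_w$ on $\Lambda^\bullet W^*$, combined with tensoring or contracting with $\alpha$ (signed $t_\alpha$), or, for the maps $\Omega^0(\Lambda^2W^*)\to\Omega^0(S_-\otimes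 W^*)$ and $\Omega^0(S_-\otimes\Lambda^3W^*)\to\Omega^0(\Lambda^2W^*)$, with the first-order operator $d_\alpha$ given by tensoring with $\alpha$ and $S_+\otimes S_-\cong\mathbb C^4$. Let $Q_{\mathrm{hol}}=\alpha_1\otimes e_2$, and let $\alpha_{\mathrm{hol}}$ be the action of $\mathrm U(1)\subset\mathrm{SL}(W)$ with weights $-1,1,0,0$ on $e_1,e_2,f_1,f_2$. The twist by $(Q_{\mathrm{hol}},\alpha_{\mathrm{hol}})$ is the same space of fields with the same pairing, with the action of $Q_{\mathrm{hol}}$ added to the differential and with the $\alpha_{\mathrm{hol}}$-weight added to the cohomological degree and, mod $2$, to the fermionic degree. Holomorphic BF theory is $(\Omega^{\bullet,\bullet}(\mathbb C^2;\mathfrak g[1]\oplus\mathfrak g),\bar\partial)$, where $\Omega^{p,q}$ has cohomological degree $q-1$ on $\mathfrak g[1]$ and $q$ on $\mathfrak g$, and fermionic degree $p$ mod $2$. Its symplectic pairing is the antisymmetric extension of $(a,b)\mapsto(-1)^{|a|}\kappa(a\wedge b)$, $a\in\Omega^{\bullet,\bullet}(\mathfrak g[1])$, $b\in\Omega^{\bullet,\bullet}(\mathfrak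 g)$, with $|a|$ the form degree. **Theorem.** Forgetting the brackets, both the twist and holomorphic BF theory are (free) classical BV theories: cochain complexes of differential operators, with a nondegenerate antisymmetric pairing of degree $-1$ that is invariant under the differential up to total derivatives. The twist has holomorphic BF theory as a deformation retract compatible with the symplectic pairings. That is, there are linear differential operators $i$ (from BF theory to the twist), $p$ (back), of bidegree $(0,0)$, and $h$ (on the twist), of bidegree $(-1,0)$, such that $i$ and $p$ are cochain maps, $p\circ i=\mathrm{id}$, $i\circ p-\mathrm{id}=Dh+hD$ with $D$ the twisted differential, and $$\int\omega(ia,ib)=\int\omega_{BF}(a,b),\qquad \int\omega(ia,y)=\int\omega_{BF}(a,py)$$ for all compactly supported $a$ and all $b$, $y$. -/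

import Mathlib

open scoped ContDiff TensorProduct

noncomputable section

/-! ### Smooth functions on `ℂ²` with values in a complex vector space -/

/-- The manifold `ℂ² = ℝ⁴` with complex coordinates `z 0`, `z 1`. -/
abbrev C2 : Type := Fin 2 → ℂ

/-- The algebra `C^∞(ℂ²)` of complex valued functions that are smooth in the real sense. -/
def smoothSubalgebra : Subalgebra ℂ (C2 → ℂ) where
  carrier := {f | ContDiff ℝ ∞ f}
  mul_mem' {f g} (hf : ContDiff ℝ ∞ f) (hg : ContDiff ℝ ∞ g) :=
    show ContDiff ℝ ∞ (f * g) from hf.mul hg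
  add_mem' {f g} (hf : ContDiff ℝ ∞ f) (hg : ContDiff ℝ ∞ g) :=
    show ContDiff ℝ ∞ (f + g) from hf.add hg
  algebraMap_mem' c := show ContDiff ℝ ∞ (fun _ : C2 => c) from contDiff_const

/-- `C^∞(ℂ²)` as a type. -/
def SmoothFn : Type := smoothSubalgebra

instance : CommRing SmoothFn := inferInstanceAs (CommRing smoothSubalgebra)

instance : Algebra ℂ SmoothFn := inferInstanceAs (Algebra ℂ smoothSubalgebra)

/-- The derivative of smooth functions in a constant real direction `v`. -/
def dirDeriv (v : C2) : SmoothFn →ₗ[ℂ] SmoothFn where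
  toFun f := ⟨fun z => fderiv ℝ f.1 z v,
    ((show ContDiff ℝ ∞ f.1 from f.2).fderiv_right (m := ∞) (by simp)).clm_apply contDiff_const⟩
  map_add' f g := by
    refine Subtype.ext (funext fun z => ?_)
    have hf := ((show ContDiff ℝ ∞ f.1 from f.2).differentiable (by simp)) z
    have hg := ((show ContDiff ℝ ∞ g.1 from g.2).differentiable (by simp)) z
    show fderiv ℝ (f.1 + g.1) z v = fderiv ℝ f.1 z v + fderiv ℝ g.1 z v
    rw [fderiv_add hf hg]; rfl
  map_smul' c f := by
    refine Subtype.ext (funext fun z => ?_)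
    have hf := ((show ContDiff ℝ ∞ f.1 from f.2).differentiable (by simp)) z
    show fderiv ℝ (c • f.1) z v = c • fderiv ℝ f.1 z v
    rw [fderiv_const_smul hf]; rfl

/-- `∂/∂z_k = (∂/∂x_k - i ∂/∂y_k)/2`. -/
def delFn (k : Fin 2) : SmoothFn →ₗ[ℂ] SmoothFn :=
  (1 / 2 : ℂ) • (dirDeriv (Pi.single k 1) - Complex.I • dirDeriv (Pi.single k Complex.I))

/-- `∂/∂z̄_k = (∂/∂x_k + i ∂/∂y_k)/2`. -/
def delbarFn (k : Fin 2) : SmoothFn →ₗ[ℂ] SmoothFn :=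
  (1 / 2 : ℂ) • (dirDeriv (Pi.single k 1) + Complex.I • dirDeriv (Pi.single k Complex.I))

/-- `C^∞(ℂ²) ⊗ 𝔤`, the smooth `𝔤`-valued functions on `ℂ²` (`𝔤` is finite dimensional). -/
def Fld (𝔤 : Type*) [AddCommGroup 𝔤] [Module ℂ 𝔤] : Type _ := SmoothFn ⊗[ℂ] 𝔤

instance (𝔤 : Type*) [AddCommGroup 𝔤] [Module ℂ 𝔤] : AddCommGroup (Fld 𝔤) :=
  inferInstanceAs (AddCommGroup (SmoothFn ⊗[ℂ] 𝔤))

instance (𝔤 : Type*) [AddCommGroup 𝔤] [Module ℂ 𝔤] : Module ℂ (Fld 𝔤) :=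
  inferInstanceAs (Module ℂ (SmoothFn ⊗[ℂ] 𝔤))

section Fields

variable {𝔤 : Type*} [AddCommGroup 𝔤] [Module ℂ 𝔤]

/-- `∂/∂z_k` on `𝔤`-valued functions. -/
def del (k : Fin 2) : Fld 𝔤 →ₗ[ℂ] Fld 𝔤 := (delFn k).rTensor 𝔤

/-- `∂/∂z̄_k` on `𝔤`-valued functions. -/
def delbar (k : Fin 2) : Fld 𝔤 →ₗ[ℂ] Fld 𝔤 := (delbarFn k).rTensor 𝔤

/-- Evaluation of smooth functions at a point. -/
def evalFn (z : C2) : SmoothFn →ₗ[ℂ] ℂ where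
  toFun f := f.1 z
  map_add' _ _ := rfl
  map_smul' _ _ := rfl

/-- The value in `𝔤` at the point `z` of a `𝔤`-valued function. -/
def Fld.value (x : Fld 𝔤) (z : C2) : 𝔤 := TensorProduct.lid ℂ 𝔤 ((evalFn z).rTensor 𝔤 x)

/-- The pointwise pairing `(f ⊗ x, g ⊗ y) ↦ f g κ(x, y)`. -/
def fldPair (κ : LinearMap.BilinForm ℂ 𝔤) : Fld 𝔤 →ₗ[ℂ] Fld 𝔤 →ₗ[ℂ] SmoothFn :=
  (LinearMap.BilinMap.tmul (LinearMap.mul ℂ SmoothFn) κ).compr₂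
    (TensorProduct.rid ℂ SmoothFn).toLinearMap

/-- The algebra of linear differential operators on `C^∞(ℂ²) ⊗ 𝔤`: it is generated by the partial
derivatives, multiplication by smooth functions, and endomorphisms of `𝔤`. -/
def diffOps (𝔤 : Type*) [AddCommGroup 𝔤] [Module ℂ 𝔤] : Subalgebra ℂ (Module.End ℂ (Fld 𝔤)) :=
  Algebra.adjoin ℂ (Set.range del ∪ Set.range delbar ∪
    Set.range (fun f : SmoothFn => (LinearMap.mulLeft ℂ f).rTensor 𝔤) ∪
    Set.range (fun u : Module.End ℂ 𝔤 => u.lTensor SmoothFn))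

end Fields

/-- `∫_{ℂ²} f dz₁ ∧ dz₂ ∧ dz̄₁ ∧ dz̄₂`; in the standard orientation
`dz₁ ∧ dz₂ ∧ dz̄₁ ∧ dz̄₂` is `4` times Lebesgue measure. -/
def integralTop (f : SmoothFn) : ℂ := 4 * ∫ z : C2, f.1 z

/-- For `S ⊆ Fin n`, the sign of the shuffle that moves `S` in front of its complement. -/
def shuffleSign {n : ℕ} (S : Finset (Fin n)) : ℂ :=
  (-1) ^ ((S ×ˢ Sᶜ).filter (fun p => p.2 < p.1)).card

/-- The sign `(-1)^{#{b ∈ S, b < a}}`, by which `e_a ∧ e_S = ± e_{S ∪ {a}}` for `a ∉ S`. -/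
def insertSign {n : ℕ} (a : Fin n) (S : Finset (Fin n)) : ℂ :=
  (-1) ^ (S.filter (fun b => b < a)).card

/-! ### Complex differential forms on `ℂ²` in the frame `dz_I ∧ dz̄_J` -/

/-- The index `(I, J)` stands for the form `dz_I ∧ dz̄_J`, of type `(|I|, |J|)`. -/
abbrev FormIdx : Type := Finset (Fin 2) × Finset (Fin 2)

/-- The indices of forms of total degree `n`. -/
abbrev FormIdxOf (n : ℕ) : Type := {F : FormIdx // F.1.card + F.2.card = n}

section Forms

variable {𝔤 : Type*} [AddCommGroup 𝔤] [Module ℂ 𝔤]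

/-- The coefficient of `dz_I ∧ dz̄_J` in a `𝔤`-valued form. -/
def formComp (F : FormIdx) : (FormIdx → Fld 𝔤) →ₗ[ℂ] Fld 𝔤 := LinearMap.proj F

/-- `∂` on `𝔤`-valued forms `∑ ω_{I,J} dz_I ∧ dz̄_J`. -/
def delForm : (FormIdx → Fld 𝔤) →ₗ[ℂ] (FormIdx → Fld 𝔤) :=
  LinearMap.pi fun F => ∑ i ∈ F.1, insertSign i (F.1.erase i) •
    (del i ∘ₗ LinearMap.proj (F.1.erase i, F.2))

/-- `∂̄` on `𝔤`-valued forms; the factor `(-1)^{|I|}` comes from moving `dz̄_j` past `dz_I`. -/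
def delbarForm : (FormIdx → Fld 𝔤) →ₗ[ℂ] (FormIdx → Fld 𝔤) :=
  LinearMap.pi fun F => ∑ j ∈ F.2, ((-1) ^ F.1.card * insertSign j (F.2.erase j)) •
    (delbar j ∘ₗ LinearMap.proj (F.1, F.2.erase j))

/-- A form of degree `n`, extended by zero to the components of the other degrees. -/
def formExt (n : ℕ) : (FormIdxOf n → Fld 𝔤) →ₗ[ℂ] (FormIdx → Fld 𝔤) :=
  LinearMap.pi fun F => if h : F.1.card + F.2.card = n then LinearMap.proj ⟨F, h⟩ else 0

/-- The de Rham differential `d = ∂ + ∂̄`. -/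
def dForm : (FormIdx → Fld 𝔤) →ₗ[ℂ] (FormIdx → Fld 𝔤) := delForm + delbarForm

/-- The sign with `dz_I ∧ dz̄_J ∧ dz_{Iᶜ} ∧ dz̄_{Jᶜ} = ± dz₁ ∧ dz₂ ∧ dz̄₁ ∧ dz̄₂`. -/
def wedgeSign (F : FormIdx) : ℂ :=
  (-1) ^ (F.2.card * F.1ᶜ.card) * shuffleSign F.1 * shuffleSign F.2

/-- The coefficient of `dz₁ ∧ dz₂ ∧ dz̄₁ ∧ dz̄₂` in `κ(a ∧ b)`. -/
def formPair (κ : LinearMap.BilinForm ℂ 𝔤) :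
    (FormIdx → Fld 𝔤) →ₗ[ℂ] (FormIdx → Fld 𝔤) →ₗ[ℂ] SmoothFn :=
  ∑ F : FormIdx, wedgeSign F •
    (fldPair κ).compl₁₂ (LinearMap.proj F) (LinearMap.proj (F.1ᶜ, F.2ᶜ))

/-- The coordinates of a self-dual two-form, for the standard orientation and metric of
`ℂ² = ℝ⁴`, where `Ω²₊ = Ω^{2,0} ⊕ Ω^{0,2} ⊕ Ω^{1,1}_∥`. They refer to the frame `dz₁ ∧ dz₂`,
`dz̄₁ ∧ dz̄₂`, `dz₁ ∧ dz̄₁ + dz₂ ∧ dz̄₂`. -/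
inductive SD : Type
  | hol
  | anti
  | kah
  deriving DecidableEq

instance : Fintype SD := ⟨{.hol, .anti, .kah}, fun s => by cases s <;> simp⟩

/-- The inclusion of self-dual two-forms into all forms. -/
def sdIncl : (SD → Fld 𝔤) →ₗ[ℂ] (FormIdx → Fld 𝔤) :=
  LinearMap.pi fun F =>
    if F = ({0, 1}, ∅) then LinearMap.proj SD.hol
    else if F = (∅, {0, 1}) then LinearMap.proj SD.anti
    else if F = ({0}, {0}) ∨ F = ({1}, {1}) then LinearMap.proj SD.kah
    else 0

/-- The projection `P₊` of a form to its self-dual two-form part. -/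
def sdProj : (FormIdx → Fld 𝔤) →ₗ[ℂ] (SD → Fld 𝔤) :=
  LinearMap.pi fun s => match s with
    | .hol => formComp ({0, 1}, ∅)
    | .anti => formComp (∅, {0, 1})
    | .kah => (1 / 2 : ℂ) • (formComp ({0}, {0}) + formComp ({1}, {1}))

end Forms

/-! ### Free classical BV theories and deformation retracts -/

/-- The data of a (free) `ℤ × ℤ/2`-graded classical BV theory on `ℂ²` with fields the sections of a
trivial bundle with fibre `ℂ^ι ⊗ 𝔤`: the cohomological degree and the fermionic degree of each
component, a differential, and a pairing with values in densities (a function `f` stands for the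
density `f dz₁ ∧ dz₂ ∧ dz̄₁ ∧ dz̄₂`). -/
structure BVData (𝔤 : Type*) [AddCommGroup 𝔤] [Module ℂ 𝔤] where
  ι : Type
  [fin : Fintype ι]
  [dec : DecidableEq ι]
  deg : ι → ℤ
  par : ι → ZMod 2
  d : (ι → Fld 𝔤) →ₗ[ℂ] (ι → Fld 𝔤)
  pair : (ι → Fld 𝔤) →ₗ[ℂ] (ι → Fld 𝔤) →ₗ[ℂ] SmoothFn

attribute [instance] BVData.fin BVData.dec

namespace BVData

variable {𝔤 : Type*} [AddCommGroup 𝔤] [Module ℂ 𝔤]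

/-- The space of fields. -/
abbrev Fields (X : BVData 𝔤) : Type _ := X.ι → Fld 𝔤

/-- A field with compact support. -/
def CompactSupp (X : BVData 𝔤) (x : X.Fields) : Prop :=
  ∀ i, HasCompactSupport (x i).value

/-- The matrix entry of an operator between two spaces of fields. -/
def entry {X Y : BVData 𝔤} (T : X.Fields →ₗ[ℂ] Y.Fields) (j : Y.ι) (i : X.ι) :
    Module.End ℂ (Fld 𝔤) :=
  LinearMap.proj j ∘ₗ T ∘ₗ LinearMap.single ℂ (fun _ => Fld 𝔤) i

/-- `T` is a linear differential operator. -/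
def IsDiffOp {X Y : BVData 𝔤} (T : X.Fields →ₗ[ℂ] Y.Fields) : Prop :=
  ∀ j i, entry T j i ∈ diffOps 𝔤

/-- `T` raises the cohomological degree by `n` and preserves the fermionic degree. -/
def HasDegree {X Y : BVData 𝔤} (T : X.Fields →ₗ[ℂ] Y.Fields) (n : ℤ) : Prop :=
  ∀ j i, entry T j i ≠ 0 → Y.deg j = X.deg i + n ∧ Y.par j = X.par i

/-- The sign `(-1)^{|i|}` for the total parity of the component `i`. -/
def sign (X : BVData 𝔤) (i : X.ι) : ℂ := (-1) ^ (X.deg i + ((X.par i).val : ℤ))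

/-- The axioms of a free classical BV theory: `d` is a differential operator of degree one and
square zero, and `pair` is an antisymmetric nondegenerate pairing of degree `-1` that is invariant
under `d` up to total derivatives. (Elements that pair nontrivially have opposite total parity, so
graded antisymmetry is plain antisymmetry.) -/
structure IsBVTheory (X : BVData 𝔤) : Prop where
  diffOp : IsDiffOp (X := X) (Y := X) X.d
  degree : HasDegree (X := X) (Y := X) X.d 1
  sq_zero : X.d ∘ₗ X.d = 0
  antisymm : ∀ x y, X.pair x y = - X.pair y x
  shifted : ∀ i j (m n : Fld 𝔤), X.pair (Pi.single i m) (Pi.single j n) ≠ 0 →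
    X.deg i + X.deg j = 1 ∧ X.par i = X.par j
  nondegenerate : ∀ x, (∀ y, X.pair x y = 0) → x = 0
  invariant : ∀ i (m : Fld 𝔤) (y : X.Fields), HasCompactSupport m.value →
    integralTop (X.pair (X.d (Pi.single i m)) y) +
      X.sign i * integralTop (X.pair (Pi.single i m) (X.d y)) = 0

/-- A deformation retraction of the cochain complex `X` onto the cochain complex `X₀`, given by
differential operators. -/
structure DeformationRetract (X₀ X : BVData 𝔤) where
  i : X₀.Fields →ₗ[ℂ] X.Fields
  p : X.Fields →ₗ[ℂ] X₀.Fields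
  h : X.Fields →ₗ[ℂ] X.Fields
  i_diffOp : IsDiffOp i
  p_diffOp : IsDiffOp p
  h_diffOp : IsDiffOp h
  i_degree : HasDegree i 0
  p_degree : HasDegree p 0
  h_degree : HasDegree h (-1)
  i_comm : X.d ∘ₗ i = i ∘ₗ X₀.d
  p_comm : X₀.d ∘ₗ p = p ∘ₗ X.d
  p_i : p ∘ₗ i = LinearMap.id
  homotopy : i ∘ₗ p - LinearMap.id = X.d ∘ₗ h + h ∘ₗ X.d

/-- The retraction is compatible with the symplectic pairings: `i` preserves them, and `p` is the
adjoint of `i`. -/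
structure DeformationRetract.IsSymplectic {X₀ X : BVData 𝔤} (R : DeformationRetract X₀ X) :
    Prop where
  isometry : ∀ a b, X₀.CompactSupp a →
    integralTop (X.pair (R.i a) (R.i b)) = integralTop (X₀.pair a b)
  adjoint : ∀ a y, X₀.CompactSupp a →
    integralTop (X.pair (R.i a) y) = integralTop (X₀.pair a (R.p y))

end BVData

/-! ### Spinors and the exterior algebra of `W*` -/

/-- The basis of `Λ^k W*`: the `k`-element subsets of the basis `e₁, e₂, f₁, f₂` of `W`, which are
numbered `0, 1, 2, 3`. -/
abbrev Lam (k : ℕ) : Type := {S : Finset (Fin 4) // S.card = k}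

/-- The complementary basis element. -/
def Lam.compl {k l : ℕ} (S : Lam k) (h : k + l = 4 := by rfl) : Lam l :=
  ⟨S.1ᶜ, by have := S.2; rw [Finset.card_compl, Fintype.card_fin]; omega⟩

/-- Contraction with `w ∈ W`, as a map `Λ^{k+1} W* ⊗ N → Λ^k W* ⊗ N`. -/
def contr {N : Type*} [AddCommGroup N] [Module ℂ N] (w : Fin 4 → ℂ) {k : ℕ}
    (x : Lam (k + 1) → N) (S : Lam k) : N :=
  ∑ a : Fin 4, if h : a ∉ S.1 then
    (insertSign a S.1 * w a) •
      x ⟨insert a S.1, by rw [Finset.card_insert_of_notMem h, S.2]⟩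
  else 0

section Spinors

variable {𝔤 : Type*} [AddCommGroup 𝔤] [Module ℂ 𝔤]

/-- The isomorphism `S₊ ⊗ S₋ ≅ ℂ⁴` of the vector representation, written as constant vector fields
`∂_{Ai}`: `α₁ ⊗ α_i^∨ ↦ ∂/∂z̄_i`, while `α₂ ⊗ α₁^∨ ↦ -∂/∂z₂` and `α₂ ⊗ α₂^∨ ↦ ∂/∂z₁`. With these
signs the determinant of `∂_{Ai}` is the Laplacian of the Euclidean metric. -/
def spinDel (A i : Fin 2) : Fld 𝔤 →ₗ[ℂ] Fld 𝔤 :=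
  ![![delbar 0, delbar 1], ![- del 1, del 0]] A i

/-- The Laplacian, normalised as `∂₁∂̄₁ + ∂₂∂̄₂`. -/
def lap : Fld 𝔤 →ₗ[ℂ] Fld 𝔤 := ∑ k : Fin 2, del k ∘ₗ delbar k

/-- The Dirac operator `S₋ → S₊`, that is `λ^i ↦ ε^{BA} ∂_{Ai} λ^i`. -/
def diracMinus : (Fin 2 → Fld 𝔤) →ₗ[ℂ] (Fin 2 → Fld 𝔤) :=
  LinearMap.pi ![∑ i, spinDel 1 i ∘ₗ LinearMap.proj i, - ∑ i, spinDel 0 i ∘ₗ LinearMap.proj i]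

/-- The Dirac operator `S₊ → S₋`, that is `χ^A ↦ ε^{ij} ∂_{Ai} χ^A`; its composites with the
previous one are the Laplacian. -/
def diracPlus : (Fin 2 → Fld 𝔤) →ₗ[ℂ] (Fin 2 → Fld 𝔤) :=
  LinearMap.pi ![- ∑ A, spinDel A 1 ∘ₗ LinearMap.proj A, ∑ A, spinDel A 0 ∘ₗ LinearMap.proj A]

/-- Tensoring with `α ∈ S₊`, as a map `ℂ → S₊`. -/
def tensorZero (α : Fin 2 → ℂ) : Fld 𝔤 →ₗ[ℂ] (Fin 2 → Fld 𝔤) :=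
  LinearMap.pi fun A => α A • LinearMap.id

/-- Tensoring with `α ∈ S₊`, as a map `S₋ → S₊ ⊗ S₋ ≅ Ω¹`, where `∂_{Ai}` corresponds to its metric
dual (up to a common factor): `α₁ ⊗ α_i^∨ ↦ dz_i`, `α₂ ⊗ α₁^∨ ↦ -dz̄₂`, `α₂ ⊗ α₂^∨ ↦ dz̄₁`. -/
def tensorOne (α : Fin 2 → ℂ) : (Fin 2 → Fld 𝔤) →ₗ[ℂ] (FormIdx → Fld 𝔤) :=
  LinearMap.pi fun F =>
    if F = ({0}, ∅) then α 0 • LinearMap.proj 0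
    else if F = ({1}, ∅) then α 0 • LinearMap.proj 1
    else if F = (∅, {0}) then α 1 • LinearMap.proj 1
    else if F = (∅, {1}) then - α 1 • LinearMap.proj 0
    else 0

/-- Tensoring with `α ∈ S₊`, as a map `S₊ → Sym² S₊ ≅ Ω²₊`, where `α₁² ↦ dz₁ ∧ dz₂`,
`α₂² ↦ dz̄₁ ∧ dz̄₂`, `2 α₁ α₂ ↦ dz₁ ∧ dz̄₁ + dz₂ ∧ dz̄₂`. -/
def tensorTwo (α : Fin 2 → ℂ) : (Fin 2 → Fld 𝔤) →ₗ[ℂ] (SD → Fld 𝔤) :=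
  LinearMap.pi fun s => match s with
    | .hol => α 0 • LinearMap.proj 0
    | .anti => α 1 • LinearMap.proj 1
    | .kah => (1 / 2 : ℂ) • (α 0 • LinearMap.proj 1 + α 1 • LinearMap.proj 0)

/-- Contraction with `α ∈ S₊ ≅ S₊*`, as a map `S₊ → ℂ`. -/
def contrOne (α : Fin 2 → ℂ) : (Fin 2 → Fld 𝔤) →ₗ[ℂ] Fld 𝔤 :=
  α 1 • LinearMap.proj 0 - α 0 • LinearMap.proj 1

/-- Contraction with `α ∈ S₊ ≅ S₊*`, as a map `Ω²₊ ≅ Sym² S₊ → S₊`. -/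
def contrTwo (α : Fin 2 → ℂ) : (SD → Fld 𝔤) →ₗ[ℂ] (Fin 2 → Fld 𝔤) :=
  LinearMap.pi
    ![α 1 • LinearMap.proj SD.hol - α 0 • LinearMap.proj SD.kah,
      α 1 • LinearMap.proj SD.kah - α 0 • LinearMap.proj SD.anti]

/-- Contraction with `α ∈ S₊ ≅ S₊*`, as a map `Ω³ ≅ S₊ ⊗ S₋ → S₋`. The two components of the image
of `θ` are the coefficients of `- σ(α ⊗ α₂^∨) ∧ θ` and `σ(α ⊗ α₁^∨) ∧ θ`, where `σ` is the above
isomorphism `S₊ ⊗ S₋ ≅ Ω¹`. -/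
def contrThree (α : Fin 2 → ℂ) : (FormIdx → Fld 𝔤) →ₗ[ℂ] (Fin 2 → Fld 𝔤) :=
  LinearMap.pi
    ![α 0 • LinearMap.proj ({0}, {0, 1}) - α 1 • LinearMap.proj ({0, 1}, {1}),
      α 0 • LinearMap.proj ({1}, {0, 1}) + α 1 • LinearMap.proj ({0, 1}, {0})]

/-- The first order operator `d_α : ℂ → S₋`, `f ↦ ε^{ij} α^A ∂_{Ai} f`. -/
def dAlphaUp (α : Fin 2 → ℂ) : Fld 𝔤 →ₗ[ℂ] (Fin 2 → Fld 𝔤) := diracPlus ∘ₗ tensorZero α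

/-- The first order operator `d_α : S₋ → ℂ`, `ν ↦ α^A ∂_{Ai} ν^i`: it tensors with `α` and
identifies `S₊ ⊗ S₋` with first order differential operators. -/
def dAlphaDown (α : Fin 2 → ℂ) : (Fin 2 → Fld 𝔤) →ₗ[ℂ] Fld 𝔤 :=
  ∑ A, ∑ i, α A • (spinDel A i ∘ₗ LinearMap.proj i)

end Spinors

/-! ### Self-dual `N = 4` super Yang-Mills theory -/

/-- The components of the (complexified) fields of self-dual `N = 4` super Yang-Mills theory on
`ℝ⁴ = ℂ²`. In the degrees `-1, 0, 1, 2` they are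
`Ω⁰, Ω¹, Ω²₊` (the gauge multiplet `c`, `A` and the antifield `BSt`),
`S₋ ⊗ W*` (`lam`) and `S₊ ⊗ W*` (`chiSt`),
`Λ²W*` (`phi`) and `Λ²W*` (`phiSt`),
`S₊ ⊗ Λ³W*` (`chi`) and `S₋ ⊗ Λ³W*` (`lamSt`),
`Ω²₊ ⊗ Λ⁴W*`, `Ω³ ⊗ Λ⁴W*`, `Ω⁴ ⊗ Λ⁴W*` (`B`, `ASt`, `cSt`, in the degrees `0, 1, 2`). -/
inductive SYMIdx : Type
  | c (S : Lam 0)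
  | A (S : Lam 0) (F : FormIdxOf 1)
  | BSt (S : Lam 0) (s : SD)
  | lam (S : Lam 1) (i : Fin 2)
  | chiSt (S : Lam 1) (C : Fin 2)
  | phi (S : Lam 2)
  | phiSt (S : Lam 2)
  | chi (S : Lam 3) (C : Fin 2)
  | lamSt (S : Lam 3) (i : Fin 2)
  | B (S : Lam 4) (s : SD)
  | ASt (S : Lam 4) (F : FormIdxOf 3)
  | cSt (S : Lam 4)
  deriving DecidableEq, Fintype

namespace SYMIdx

/-- The cohomological degree. -/
def deg : SYMIdx → ℤ
  | c _ => -1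
  | A _ _ | lam _ _ | phi _ | chi _ _ | B _ _ => 0
  | BSt _ _ | chiSt _ _ | phiSt _ | lamSt _ _ | ASt _ _ => 1
  | cSt _ => 2

/-- The factor in `Λ W*`. -/
def wPart : SYMIdx → Finset (Fin 4)
  | c S | A S _ | BSt S _ => S.1
  | lam S _ | chiSt S _ => S.1
  | phi S | phiSt S => S.1
  | chi S _ | lamSt S _ => S.1
  | B S _ | ASt S _ | cSt S => S.1

/-- The fermionic degree: `Λ^k W*` has degree `k` modulo `2`. -/
def par (t : SYMIdx) : ZMod 2 := t.wPart.card

end SYMIdx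

section SYM

variable {𝔤 : Type*} [AddCommGroup 𝔤] [Module ℂ 𝔤]

/-- The space of fields. -/
abbrev SYMFields (𝔤 : Type*) [AddCommGroup 𝔤] [Module ℂ 𝔤] : Type _ := SYMIdx → Fld 𝔤

/-- One component of a field. -/
def comp (t : SYMIdx) : SYMFields 𝔤 →ₗ[ℂ] Fld 𝔤 := LinearMap.proj t

/-- The selection of the components `f k` of a field. -/
def pick {K : Type} (f : K → SYMIdx) : SYMFields 𝔤 →ₗ[ℂ] (K → Fld 𝔤) :=
  LinearMap.pi fun k => comp (f k)

/-- The differential of the classical BV complex of self-dual `N = 4` super Yang-Mills theory. -/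
def symD : SYMFields 𝔤 →ₗ[ℂ] SYMFields 𝔤 :=
  LinearMap.pi fun t => match t with
    | .c _ | .lam _ _ | .phi _ | .chi _ _ | .B _ _ => 0
    | .A S F => LinearMap.proj F.1 ∘ₗ dForm ∘ₗ formExt 0 ∘ₗ pick (fun _ => .c S)
    | .BSt S s => LinearMap.proj s ∘ₗ sdProj ∘ₗ dForm ∘ₗ formExt 1 ∘ₗ pick (.A S)
    | .chiSt S C => LinearMap.proj C ∘ₗ diracMinus ∘ₗ pick (.lam S)
    | .phiSt S => lap ∘ₗ comp (.phi S)
    | .lamSt S i => LinearMap.proj i ∘ₗ diracPlus ∘ₗ pick (.chi S)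
    | .ASt S F => LinearMap.proj F.1 ∘ₗ dForm ∘ₗ sdIncl ∘ₗ pick (.B S)
    | .cSt S => LinearMap.proj (Finset.univ, Finset.univ) ∘ₗ dForm ∘ₗ formExt 3 ∘ₗ pick (.ASt S)

/-- The action on the BV complex of the supertranslation `Q = α ⊗ w ∈ S₊ ⊗ W`. -/
def symQ (α : Fin 2 → ℂ) (w : Fin 4 → ℂ) : SYMFields 𝔤 →ₗ[ℂ] SYMFields 𝔤 :=
  LinearMap.pi fun t => match t with
    | .c _ | .B _ _ | .ASt _ _ | .cSt _ => 0
    | .A S F => - (LinearMap.proj F.1 ∘ₗ tensorOne α ∘ₗ contr w (fun T => pick (𝔤 := 𝔤) (.lam T)) S)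
    | .BSt S s => LinearMap.proj s ∘ₗ tensorTwo α ∘ₗ contr w (fun T => pick (𝔤 := 𝔤) (.chiSt T)) S
    | .lam S i => LinearMap.proj i ∘ₗ dAlphaUp α ∘ₗ contr w (fun T => comp (𝔤 := 𝔤) (.phi T)) S
    | .chiSt S C =>
        - (LinearMap.proj C ∘ₗ tensorZero α ∘ₗ contr w (fun T => comp (𝔤 := 𝔤) (.phiSt T)) S)
    | .phi S => - (contrOne α ∘ₗ contr w (fun T => pick (𝔤 := 𝔤) (.chi T)) S)
    | .phiSt S => dAlphaDown α ∘ₗ contr w (fun T => pick (𝔤 := 𝔤) (.lamSt T)) S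
    | .chi S C => LinearMap.proj C ∘ₗ contrTwo α ∘ₗ contr w (fun T => pick (𝔤 := 𝔤) (.B T)) S
    | .lamSt S i =>
        - (LinearMap.proj i ∘ₗ contrThree α ∘ₗ formExt 3 ∘ₗ contr w (fun T => pick (𝔤 := 𝔤) (.ASt T)) S)

/-- The pairing of a component with a component, with the invariant form on `𝔤`. -/
def compPair (κ : LinearMap.BilinForm ℂ 𝔤) (s t : SYMIdx) :
    SYMFields 𝔤 →ₗ[ℂ] SYMFields 𝔤 →ₗ[ℂ] SmoothFn :=
  (fldPair κ).compl₁₂ (comp s) (comp t)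

/-- The pairing of the fields `c, A, lam, phi, chi, B` with their antifields: the wedge product on
forms and on `Λ W*` (with `Λ⁴ W* = ℂ`), the invariant area forms on `S₊` and `S₋`, and the form `κ`
on `𝔤`. -/
def symHalfPair (κ : LinearMap.BilinForm ℂ 𝔤) :
    SYMFields 𝔤 →ₗ[ℂ] SYMFields 𝔤 →ₗ[ℂ] SmoothFn :=
  - ∑ S : Lam 0, shuffleSign S.1 • compPair κ (.c S) (.cSt S.compl)
  + ∑ S : Lam 0, shuffleSign S.1 • (formPair κ).compl₁₂
      (formExt 1 ∘ₗ pick (.A S)) (formExt 3 ∘ₗ pick (.ASt S.compl))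
  + ∑ S : Lam 1, shuffleSign S.1 •
      (compPair κ (.lam S 0) (.lamSt S.compl 1) - compPair κ (.lam S 1) (.lamSt S.compl 0))
  + ∑ S : Lam 2, shuffleSign S.1 • compPair κ (.phi S) (.phiSt S.compl)
  + ∑ S : Lam 3, shuffleSign S.1 •
      (compPair κ (.chi S 0) (.chiSt S.compl 1) - compPair κ (.chi S 1) (.chiSt S.compl 0))
  + ∑ S : Lam 4, shuffleSign S.1 • (formPair κ).compl₁₂
      (sdIncl ∘ₗ pick (.B S)) (sdIncl ∘ₗ pick (.BSt S.compl))

/-- The free part of self-dual `N = 4` super Yang-Mills theory. -/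
def selfDualSYM (κ : LinearMap.BilinForm ℂ 𝔤) : BVData 𝔤 where
  ι := SYMIdx
  deg := SYMIdx.deg
  par := SYMIdx.par
  d := symD
  pair := symHalfPair κ - (symHalfPair κ).flip

/-- A twisting datum whose supercharge `Q = α ⊗ w` is a decomposable element of `S₊ ⊗ W`. Such a
supercharge squares to zero, as the bracket pairs `S₊ ⊗ W` with `S₋ ⊗ W*` only. The
circle acts through the diagonal torus of the R-symmetry group `SL(W)`, with the weights `wt` on the
basis of `W`, and `Q` has weight one. -/
structure TwistingDatum where
  α : Fin 2 → ℂ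
  w : Fin 4 → ℂ
  wt : Fin 4 → ℤ
  wt_sum : ∑ a, wt a = 0
  wt_Q : ∀ a, w a ≠ 0 → wt a = 1

/-- The weight of the circle action on a component of the fields; `W*` has the dual weights. -/
def TwistingDatum.weight (Q : TwistingDatum) (t : SYMIdx) : ℤ := - ∑ a ∈ t.wPart, Q.wt a

/-- The twisted theory: the action of `Q` is added to the differential, and the weight to the
cohomological degree. The fermionic degree is shifted by the weight too, so that the total parity
of a field does not change, and `Q` preserves the new fermionic degree. -/
def twistedSYM (κ : LinearMap.BilinForm ℂ 𝔤) (Q : TwistingDatum) : BVData 𝔤 where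
  ι := SYMIdx
  deg t := t.deg + Q.weight t
  par t := t.par + (Q.weight t : ZMod 2)
  d := symD + symQ Q.α Q.w
  pair := (selfDualSYM κ).pair

/-- The holomorphic twisting datum: `Q = α₁ ⊗ e₂`, and `e₁, e₂, f₁, f₂` have the weights
`-1, 1, 0, 0`. -/
def holTwist : TwistingDatum where
  α := Pi.single 0 1
  w := Pi.single 1 1
  wt := ![-1, 1, 0, 0]
  wt_sum := by simp [Fin.sum_univ_four]
  wt_Q a h := by
    by_cases ha : a = 1
    · subst ha; rfl
    · exact absurd (Pi.single_eq_of_ne ha 1) h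

/-! ### Holomorphic BF theory -/

/-- The forms with values in the summand `𝔤[1]` (for `false`) or `𝔤` (for `true`). -/
def bfPick (ε : Bool) : (Bool × FormIdx → Fld 𝔤) →ₗ[ℂ] (FormIdx → Fld 𝔤) :=
  LinearMap.pi fun F => LinearMap.proj (ε, F)

/-- The pairing of the two copies of `𝔤`: for `a` with values in `𝔤[1]` and `b` with values in `𝔤`
it is `(-1)^{|a|} κ(a ∧ b)`, with `|a|` the form degree. -/
def bfHalfPair (κ : LinearMap.BilinForm ℂ 𝔤) :
    (Bool × FormIdx → Fld 𝔤) →ₗ[ℂ] (Bool × FormIdx → Fld 𝔤) →ₗ[ℂ] SmoothFn :=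
  (formPair κ).compl₁₂
    (LinearMap.pi fun F => ((-1 : ℂ) ^ (F.1.card + F.2.card)) • LinearMap.proj (false, F))
    (bfPick true)

/-- Holomorphic BF theory `(Ω^{•,•}(ℂ²; 𝔤[1] ⊕ 𝔤), ∂̄)`: a form of type `(p, q)` has the degree
`q - 1` or `q`, and the fermionic degree `p` modulo `2`. -/
def holBF (κ : LinearMap.BilinForm ℂ 𝔤) : BVData 𝔤 where
  ι := Bool × FormIdx
  deg t := (t.2.2.card : ℤ) - (if t.1 then 0 else 1)
  par t := (t.2.1.card : ZMod 2)
  d := LinearMap.pi fun t => LinearMap.proj t.2 ∘ₗ delbarForm ∘ₗ bfPick t.1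
  pair := bfHalfPair κ - (bfHalfPair κ).flip

end SYM

end

noncomputable section

set_option linter.unusedSimpArgs false

/-! ### Derivatives of smooth functions -/

namespace SmoothFn

/-! Contraction with `e₂` matches every basis vector of `ΛW*` that contains the dual vector `e₂*`
with the one obtained by deleting it. The twisted complex therefore splits into a block `vec` (the
rows of `1` and `e₂*`), the dual block `vecSt`, and, for each of the other three dual basis vectors
`w`, a block `scalar` (the rows of `w` and `e₂* ∧ w`) with its dual block `scalarSt`.

In each block the order-zero part of `Q` cancels components in pairs: in `vec` the two `(1,0)`-forms
against `lam` and two of the three self-dual forms against `chiSt`; in `scalar` the field `phiSt`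
against `chiSt0`; in `scalarSt` and `vecSt` the dual pairs. Four components survive, and the
remaining differential on them is `∂̄` up to sign; in the scalar blocks one of its two arrows comes
from the Dirac operator and the other from `d_α`. This gives eight Dolbeault complexes `Ω^{0,•}`,
which are the summands `dz_I` of the two copies of `𝔤` in BF theory: `vec` is `(0,•)` in `𝔤[1]`,
`vecSt` is `(2,•)` in `𝔤`, and the weights of `e₁, f₁, f₂` put the other six in the right degrees.

The homotopy `h` is, up to sign, the inverse of the cancelling part. If `δ` is the rest of the
differential, then `h δ h = 0`, so the perturbation series for the inclusion and the projection stop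
after one derivative and `h` needs no correction. The inclusion is corrected in `vec` and `scalar`,
the projection in the dual blocks, and integration by parts exchanges the two corrections.
Compatibility with the pairings is thus the adjunction `inclMap_adjoint`; the isometry follows from
it and `p ∘ i = id`.

For explicit models, `twD_twD`, `twD_inclMap`, `bfD_projMap` and `inclMap_projMap_sub` are
identities between polynomials in the commuting operators `∂_k, ∂̄_k`. Invariance and adjunction are
checked in the quotient by total derivatives, where integration by parts is an exact linear rule.
The models are identified with the actual theories by `holTwistD_twIdx`, `symHalfPair_sub`,
`delbarForm_bfPick` and `bfHalfPair_sub`, and everything is transported along `Reindexing`. -/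

theorem contDiff (f : SmoothFn) : ContDiff ℝ ∞ f.1 := f.2

theorem differentiable (f : SmoothFn) : Differentiable ℝ f.1 := f.contDiff.differentiable (by simp)

theorem dirDeriv_comm (v w : C2) (f : SmoothFn) :
    dirDeriv v (dirDeriv w f) = dirDeriv w (dirDeriv v f) := by
  refine Subtype.ext (funext fun z => ?_)
  have hd : DifferentiableAt ℝ (fderiv ℝ f.1) z :=
    (f.contDiff.fderiv_right (m := ∞) (by simp)).differentiable (by simp) z
  have key (a b : C2) :
      fderiv ℝ (fun y => fderiv ℝ f.1 y a) z b = fderiv ℝ (fderiv ℝ f.1) z b a := by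
    have := hd.hasFDerivAt.clm_apply (hasFDerivAt_const a z)
    rw [this.fderiv]; simp
  have hs : IsSymmSndFDerivAt ℝ f.1 z :=
    f.contDiff.contDiffAt.isSymmSndFDerivAt (by
      rw [minSmoothness_of_isRCLikeNormedField]; exact WithTop.coe_le_coe.2 le_top)
  show fderiv ℝ (fun y => fderiv ℝ f.1 y w) z v = fderiv ℝ (fun y => fderiv ℝ f.1 y v) z w
  rw [key, key, hs v w]

theorem dirDeriv_mul (v : C2) (f g : SmoothFn) :
    dirDeriv v (f * g) = dirDeriv v f * g + f * dirDeriv v g := by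
  refine Subtype.ext (funext fun z => ?_)
  show fderiv ℝ (f.1 * g.1) z v = fderiv ℝ f.1 z v * g.1 z + f.1 z * fderiv ℝ g.1 z v
  rw [fderiv_mul (f.differentiable z) (g.differentiable z)]
  simp; ring

/-- The smooth functions with compact support. -/
def compactSupp : Submodule ℂ SmoothFn where
  carrier := {f | HasCompactSupport f.1}
  zero_mem' := HasCompactSupport.zero
  add_mem' hf hg := HasCompactSupport.add hf hg
  smul_mem' c f (hf : HasCompactSupport f.1) :=
    hf.mono (Function.support_const_smul_subset c f.1)

theorem dirDeriv_mem_compactSupp (v : C2) {f : SmoothFn} (hf : f ∈ compactSupp) :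
    dirDeriv v f ∈ compactSupp :=
  HasCompactSupport.fderiv_apply ℝ (f := f.1) hf v

theorem mul_mem_compactSupp (f : SmoothFn) {g : SmoothFn} (hg : g ∈ compactSupp) :
    f * g ∈ compactSupp :=
  HasCompactSupport.mul_left (f := f.1) (f' := g.1) hg

theorem integrable {f : SmoothFn} (hf : f ∈ compactSupp) : MeasureTheory.Integrable f.1 :=
  f.contDiff.continuous.integrable_of_hasCompactSupport hf

/-- The integral as a linear form on the compactly supported functions. -/
def integral : compactSupp →ₗ[ℂ] ℂ where
  toFun f := integralTop f.1
  map_add' f g := by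
    show 4 * ∫ z, (f.1.1 z + g.1.1 z) = 4 * (∫ z, f.1.1 z) + 4 * ∫ z, g.1.1 z
    rw [MeasureTheory.integral_add (integrable f.2) (integrable g.2), mul_add]
  map_smul' c f := by
    show 4 * ∫ z, c • f.1.1 z = c • (4 * ∫ z, f.1.1 z)
    rw [MeasureTheory.integral_smul, smul_eq_mul, smul_eq_mul]; ring

/-- The total derivatives of compactly supported functions. -/
def totalDerivs : Submodule ℂ SmoothFn :=
  Submodule.span ℂ {g | ∃ v, ∃ f ∈ compactSupp, g = dirDeriv v f}

theorem totalDerivs_le : totalDerivs ≤ compactSupp := by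
  refine Submodule.span_le.2 ?_
  rintro _ ⟨v, f, hf, rfl⟩
  exact dirDeriv_mem_compactSupp v hf

theorem integralTop_dirDeriv (v : C2) {f : SmoothFn} (hf : f ∈ compactSupp) :
    integralTop (dirDeriv v f) = 0 := by
  -- Integration by parts against the constant function `1`.
  have h := integral_mul_fderiv_eq_neg_fderiv_mul_of_integrable
    (μ := (MeasureTheory.volume : MeasureTheory.Measure C2)) (𝕜 := ℂ) (f := fun _ => 1)
    (g := f.1) (v := v) (by simp) (by simpa using! integrable (dirDeriv_mem_compactSupp v hf))
    (by simpa using integrable hf) (fun _ _ => differentiableAt_const _)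
    (fun z _ => f.differentiable z)
  show 4 * ∫ z, fderiv ℝ f.1 z v = 0
  simp at h
  simp [h]

theorem integralTop_eq_zero {f : SmoothFn} (hf : f ∈ totalDerivs) : integralTop f = 0 := by
  -- The integral is linear only on compactly supported functions, so its kernel is pushed forward
  -- into all smooth functions before the span is compared with it.
  have : totalDerivs ≤ (LinearMap.ker integral).map compactSupp.subtype := by
    refine Submodule.span_le.2 ?_
    rintro _ ⟨v, f, hf, rfl⟩
    exact ⟨⟨_, dirDeriv_mem_compactSupp v hf⟩, integralTop_dirDeriv v hf, rfl⟩
  obtain ⟨g, hg, rfl⟩ := this hf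
  exact hg

theorem integralTop_add {f g : SmoothFn} (hf : f ∈ compactSupp) (hg : g ∈ compactSupp) :
    integralTop (f + g) = integralTop f + integralTop g :=
  integral.map_add ⟨f, hf⟩ ⟨g, hg⟩

theorem integralTop_smul (c : ℂ) {f : SmoothFn} (hf : f ∈ compactSupp) :
    integralTop (c • f) = c * integralTop f :=
  integral.map_smul c ⟨f, hf⟩

/-- Compactly supported functions with the same class modulo total derivatives have the same
integral. -/
theorem integralTop_congr {f g : SmoothFn} (hf : f ∈ compactSupp) (hg : g ∈ compactSupp)
    (h : totalDerivs.mkQ f = totalDerivs.mkQ g) : integralTop f = integralTop g := by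
  have h' : f - g ∈ totalDerivs := by
    rwa [← Submodule.ker_mkQ totalDerivs, LinearMap.mem_ker, map_sub, sub_eq_zero]
  have := integralTop_add (compactSupp.sub_mem hf hg) hg
  rwa [sub_add_cancel, integralTop_eq_zero h', zero_add] at this

end SmoothFn

/-! ### Wirtinger derivatives and their commutation -/

theorem delFn_eq (k : Fin 2) (f : SmoothFn) : delFn k f =
    (1 / 2 : ℂ) •
      (dirDeriv (Pi.single k 1) f - Complex.I • dirDeriv (Pi.single k Complex.I) f) := rfl

theorem delbarFn_eq (k : Fin 2) (f : SmoothFn) : delbarFn k f =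
    (1 / 2 : ℂ) •
      (dirDeriv (Pi.single k 1) f + Complex.I • dirDeriv (Pi.single k Complex.I) f) := rfl

section Fields

variable {𝔤 : Type*} [AddCommGroup 𝔤] [Module ℂ 𝔤]

namespace Fld

/-- The field `f ⊗ x`. -/
def tmul (f : SmoothFn) (x : 𝔤) : Fld 𝔤 := (f ⊗ₜ[ℂ] x : SmoothFn ⊗[ℂ] 𝔤)

@[elab_as_elim]
theorem induction {motive : Fld 𝔤 → Prop} (m : Fld 𝔤) (tmul : ∀ f x, motive (tmul f x))
    (add : ∀ m n, motive m → motive n → motive (m + n)) (zero : motive 0) : motive m :=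
  TensorProduct.induction_on m zero tmul add

end Fld

theorem del_tmul (k : Fin 2) (f : SmoothFn) (x : 𝔤) :
    del k (Fld.tmul f x) = Fld.tmul (delFn k f) x := rfl

theorem delbar_tmul (k : Fin 2) (f : SmoothFn) (x : 𝔤) :
    delbar k (Fld.tmul f x) = Fld.tmul (delbarFn k f) x := rfl

theorem fldPair_tmul (κ : LinearMap.BilinForm ℂ 𝔤) (f g : SmoothFn) (x y : 𝔤) :
    fldPair κ (Fld.tmul f x) (Fld.tmul g y) = κ x y • (f * g) := rfl

theorem delFn_comm (k l : Fin 2) (f : SmoothFn) : delFn k (delFn l f) = delFn l (delFn k f) := by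
  simp only [delFn_eq, map_smul, map_sub, SmoothFn.dirDeriv_comm (Pi.single k _) (Pi.single l _)]
  module

theorem delbarFn_comm (k l : Fin 2) (f : SmoothFn) :
    delbarFn k (delbarFn l f) = delbarFn l (delbarFn k f) := by
  simp only [delbarFn_eq, map_smul, map_add, SmoothFn.dirDeriv_comm (Pi.single k _) (Pi.single l _)]
  module

theorem delbarFn_delFn (k l : Fin 2) (f : SmoothFn) :
    delbarFn k (delFn l f) = delFn l (delbarFn k f) := by
  simp only [delbarFn_eq, delFn_eq, map_smul, map_add, map_sub,
    SmoothFn.dirDeriv_comm (Pi.single k _) (Pi.single l _)]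
  module

theorem del_comm (k l : Fin 2) (m : Fld 𝔤) : del k (del l m) = del l (del k m) := by
  induction m using Fld.induction with
  | tmul f x => simp only [del_tmul, delFn_comm k l]
  | add m n hm hn => simp only [map_add, hm, hn]
  | zero => simp only [map_zero]

theorem delbar_comm (k l : Fin 2) (m : Fld 𝔤) : delbar k (delbar l m) = delbar l (delbar k m) := by
  induction m using Fld.induction with
  | tmul f x => simp only [delbar_tmul, delbarFn_comm k l]
  | add m n hm hn => simp only [map_add, hm, hn]
  | zero => simp only [map_zero]

theorem delbar_del (k l : Fin 2) (m : Fld 𝔤) : delbar k (del l m) = del l (delbar k m) := by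
  induction m using Fld.induction with
  | tmul f x => simp only [del_tmul, delbar_tmul, delbarFn_delFn k l]
  | add m n hm hn => simp only [map_add, hm, hn]
  | zero => simp only [map_zero]

/-! ### The pairing of fields -/

theorem fldPair_symm {κ : LinearMap.BilinForm ℂ 𝔤} (hκ : κ.IsSymm) (m n : Fld 𝔤) :
    fldPair κ m n = fldPair κ n m := by
  induction m using Fld.induction with
  | zero => simp
  | add m m' h h' => simp [h, h']
  | tmul f x =>
    induction n using Fld.induction with
    | zero => simp
    | add n n' h h' => simp [h, h']
    | tmul g y => rw [fldPair_tmul, fldPair_tmul, mul_comm, hκ.eq]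

/-- This is the link between the support of `Fld.value`, used in the definitions, and the supports
of pairings, used in the proofs. -/
theorem fldPair_val (κ : LinearMap.BilinForm ℂ 𝔤) (m n : Fld 𝔤) (z : C2) :
    evalFn z (fldPair κ m n) = κ (m.value z) (n.value z) := by
  have hv (f : SmoothFn) (x : 𝔤) : (Fld.tmul f x).value z = evalFn z f • x := rfl
  have ha (m n : Fld 𝔤) : (m + n).value z = m.value z + n.value z :=
    (congrArg _ (map_add _ m n)).trans (map_add _ _ _)
  have h0 : (0 : Fld 𝔤).value z = 0 := (congrArg _ (map_zero _)).trans (map_zero _)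
  induction m using Fld.induction with
  | zero => simp [h0]
  | add m m' h h' => simp [h, h', ha]
  | tmul f x =>
    induction n using Fld.induction with
    | zero => simp [h0]
    | add n n' h h' => simp [h, h', ha]
    | tmul g y =>
      rw [fldPair_tmul, hv, hv]
      have : evalFn z (f * g) = evalFn z f * evalFn z g := rfl
      simp [this]; ring

theorem fldPair_nondegenerate [FiniteDimensional ℂ 𝔤] {κ : LinearMap.BilinForm ℂ 𝔤}
    (hκ : κ.Nondegenerate) (hs : κ.IsSymm) (m : Fld 𝔤) (h : ∀ n, fldPair κ m n = 0) : m = 0 := by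
  let b := Module.finBasis ℂ 𝔤
  obtain ⟨c, hc⟩ := TensorProduct.eq_repr_basis_right b (M := SmoothFn) m
  have hm : m = ∑ i, Fld.tmul (c i) (b i) := by
    rw [← hc]; exact Finsupp.sum_fintype _ _ fun i => TensorProduct.zero_tmul _ _
  have hc (i) : c i = 0 := by
    -- Pairing with the constant section given by a dual basis vector reads off the coefficient
    -- function `c i`.
    have := h (Fld.tmul 1 (κ.dualBasis hκ b i))
    simpa [hm, fldPair_tmul, LinearMap.BilinForm.apply_dualBasis_right hκ hs] using this
  rw [hm]
  exact Finset.sum_eq_zero fun i _ => by rw [hc]; exact TensorProduct.zero_tmul _ _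

/-- The fields all of whose pairings have compact support. -/
def compactFld (𝔤 : Type*) [AddCommGroup 𝔤] [Module ℂ 𝔤] : Submodule ℂ (Fld 𝔤) where
  carrier := {m | ∀ (κ : LinearMap.BilinForm ℂ 𝔤) (n : Fld 𝔤), fldPair κ m n ∈ SmoothFn.compactSupp}
  zero_mem' κ n := by simp
  add_mem' hm hm' κ n := by
    rw [map_add, LinearMap.add_apply]; exact add_mem (hm κ n) (hm' κ n)
  smul_mem' c m hm κ n := by
    rw [map_smul, LinearMap.smul_apply]; exact Submodule.smul_mem _ _ (hm κ n)

theorem mem_compactFld {m : Fld 𝔤} (hm : HasCompactSupport m.value) : m ∈ compactFld 𝔤 := by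
  intro κ n
  refine HasCompactSupport.mono (f := m.value) hm fun z hz hmz => hz ?_
  show evalFn z (fldPair κ m n) = 0
  rw [fldPair_val, hmz]; simp

/-! ### Leibniz rule and integration by parts -/

theorem delFn_mul (k : Fin 2) (f g : SmoothFn) :
    delFn k (f * g) = delFn k f * g + f * delFn k g := by
  simp only [delFn_eq, SmoothFn.dirDeriv_mul, smul_add, smul_sub, sub_mul,
    mul_sub, smul_mul_assoc, mul_smul_comm]
  abel

theorem delbarFn_mul (k : Fin 2) (f g : SmoothFn) :
    delbarFn k (f * g) = delbarFn k f * g + f * delbarFn k g := by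
  simp only [delbarFn_eq, SmoothFn.dirDeriv_mul, smul_add, add_mul, mul_add, smul_mul_assoc,
    mul_smul_comm]
  abel

theorem fldPair_del (κ : LinearMap.BilinForm ℂ 𝔤) (k : Fin 2) (m n : Fld 𝔤) :
    fldPair κ (del k m) n = delFn k (fldPair κ m n) - fldPair κ m (del k n) := by
  induction m using Fld.induction with
  | zero => simp
  | add m m' h h' => simp only [map_add, LinearMap.add_apply, h, h']; abel
  | tmul f x =>
    induction n using Fld.induction with
    | zero => simp
    | add n n' h h' => simp only [map_add, h, h']; abel
    | tmul g y => simp only [fldPair_tmul, del_tmul, map_smul, delFn_mul, smul_add]; abel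

theorem fldPair_delbar (κ : LinearMap.BilinForm ℂ 𝔤) (k : Fin 2) (m n : Fld 𝔤) :
    fldPair κ (delbar k m) n = delbarFn k (fldPair κ m n) - fldPair κ m (delbar k n) := by
  induction m using Fld.induction with
  | zero => simp
  | add m m' h h' => simp only [map_add, LinearMap.add_apply, h, h']; abel
  | tmul f x =>
    induction n using Fld.induction with
    | zero => simp
    | add n n' h h' => simp only [map_add, h, h']; abel
    | tmul g y => simp only [fldPair_tmul, delbar_tmul, map_smul, delbarFn_mul, smul_add]; abel

theorem delFn_mem_totalDerivs (k : Fin 2) {f : SmoothFn} (hf : f ∈ SmoothFn.compactSupp) :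
    delFn k f ∈ SmoothFn.totalDerivs :=
  Submodule.smul_mem _ _ (sub_mem (Submodule.subset_span ⟨_, f, hf, rfl⟩)
    (Submodule.smul_mem _ _ (Submodule.subset_span ⟨_, f, hf, rfl⟩)))

theorem delbarFn_mem_totalDerivs (k : Fin 2) {f : SmoothFn} (hf : f ∈ SmoothFn.compactSupp) :
    delbarFn k f ∈ SmoothFn.totalDerivs :=
  Submodule.smul_mem _ _ (add_mem (Submodule.subset_span ⟨_, f, hf, rfl⟩)
    (Submodule.smul_mem _ _ (Submodule.subset_span ⟨_, f, hf, rfl⟩)))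

theorem del_mem_compactFld (k : Fin 2) {m : Fld 𝔤} (hm : m ∈ compactFld 𝔤) :
    del k m ∈ compactFld 𝔤 := fun κ n => by
  rw [fldPair_del]
  exact sub_mem (SmoothFn.totalDerivs_le (delFn_mem_totalDerivs k (hm κ n))) (hm κ _)

theorem delbar_mem_compactFld (k : Fin 2) {m : Fld 𝔤} (hm : m ∈ compactFld 𝔤) :
    delbar k m ∈ compactFld 𝔤 := fun κ n => by
  rw [fldPair_delbar]
  exact sub_mem (SmoothFn.totalDerivs_le (delbarFn_mem_totalDerivs k (hm κ n))) (hm κ _)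

theorem fldPair_mul_left (κ : LinearMap.BilinForm ℂ 𝔤) {P : Module.End ℂ (Fld 𝔤)} {f : SmoothFn}
    (hP : ∀ g x, P (Fld.tmul g x) = Fld.tmul (f * g) x) (m n : Fld 𝔤) :
    fldPair κ (P m) n = f * fldPair κ m n := by
  induction m using Fld.induction with
  | zero => simp
  | add m m' h h' => simp only [map_add, LinearMap.add_apply, mul_add, h, h']
  | tmul g x =>
    induction n using Fld.induction with
    | zero => simp
    | add n n' h h' => simp only [map_add, mul_add, h, h']
    | tmul g' y => rw [hP, fldPair_tmul, fldPair_tmul, mul_smul_comm, ← mul_assoc]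

/-- An endomorphism of `𝔤` can be absorbed into the form, which need not stay symmetric or
nondegenerate. This is why `compactFld` quantifies over all bilinear forms. -/
theorem fldPair_end_left (κ : LinearMap.BilinForm ℂ 𝔤) {P : Module.End ℂ (Fld 𝔤)}
    {u : Module.End ℂ 𝔤} (hP : ∀ g x, P (Fld.tmul g x) = Fld.tmul g (u x)) (m n : Fld 𝔤) :
    fldPair κ (P m) n = fldPair (κ ∘ₗ u) m n := by
  induction m using Fld.induction with
  | zero => simp
  | add m m' h h' => simp only [map_add, LinearMap.add_apply, h, h']
  | tmul g x =>
    induction n using Fld.induction with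
    | zero => simp
    | add n n' h h' => simp only [map_add, h, h']
    | tmul g' y => rw [hP]; rfl

/-- Differential operators do not enlarge supports. -/
theorem diffOps_mem_compactFld {P : Module.End ℂ (Fld 𝔤)} (hP : P ∈ diffOps 𝔤) {m : Fld 𝔤}
    (hm : m ∈ compactFld 𝔤) : P m ∈ compactFld 𝔤 := by
  induction hP using Algebra.adjoin_induction generalizing m with
  | mem P hP =>
    rcases hP with ((⟨k, rfl⟩ | ⟨k, rfl⟩) | ⟨f, rfl⟩) | ⟨u, rfl⟩
    · exact del_mem_compactFld k hm
    · exact delbar_mem_compactFld k hm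
    · exact fun κ n => (congrArg (· ∈ SmoothFn.compactSupp) (fldPair_mul_left κ
        (P := (LinearMap.mulLeft ℂ f).rTensor 𝔤) (fun _ _ => rfl) m n)).mpr
        (SmoothFn.mul_mem_compactSupp f (hm κ n))
    · exact fun κ n => (congrArg (· ∈ SmoothFn.compactSupp) (fldPair_end_left κ
        (P := u.lTensor SmoothFn) (fun _ _ => rfl) m n)).mpr (hm (κ ∘ₗ u) n)
  | algebraMap c => exact Submodule.smul_mem _ c hm
  | add P Q _ _ hP hQ => exact add_mem (hP hm) (hQ hm)
  | mul P Q _ _ hP hQ => exact hP (hQ hm)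

/-- The pairing of fields modulo total derivatives. -/
def intPair (κ : LinearMap.BilinForm ℂ 𝔤) :
    Fld 𝔤 →ₗ[ℂ] Fld 𝔤 →ₗ[ℂ] SmoothFn ⧸ SmoothFn.totalDerivs :=
  (fldPair κ).compr₂ SmoothFn.totalDerivs.mkQ

theorem intPair_del (κ : LinearMap.BilinForm ℂ 𝔤) (k : Fin 2) {m : Fld 𝔤} (hm : m ∈ compactFld 𝔤)
    (n : Fld 𝔤) : intPair κ (del k m) n = - intPair κ m (del k n) := by
  show Submodule.mkQ _ _ = - Submodule.mkQ _ _
  rw [fldPair_del, map_sub, sub_eq_neg_self]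
  exact (Submodule.Quotient.mk_eq_zero _).2 (delFn_mem_totalDerivs k (hm κ n))

theorem intPair_delbar (κ : LinearMap.BilinForm ℂ 𝔤) (k : Fin 2) {m : Fld 𝔤}
    (hm : m ∈ compactFld 𝔤) (n : Fld 𝔤) :
    intPair κ (delbar k m) n = - intPair κ m (delbar k n) := by
  show Submodule.mkQ _ _ = - Submodule.mkQ _ _
  rw [fldPair_delbar, map_sub, sub_eq_neg_self]
  exact (Submodule.Quotient.mk_eq_zero _).2 (delbarFn_mem_totalDerivs k (hm κ n))

end Fields

/-! ### Criteria for free BV theories, and reindexing -/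

section Rows

variable {𝔤 : Type*} [AddCommGroup 𝔤] [Module ℂ 𝔤]

/-- The differential operators from a space of fields to scalar fields. -/
def rowDiffOps (𝔤 ι : Type*) [DecidableEq ι] [AddCommGroup 𝔤] [Module ℂ 𝔤] :
    Submodule ℂ ((ι → Fld 𝔤) →ₗ[ℂ] Fld 𝔤) where
  carrier := {r | ∀ i, r ∘ₗ LinearMap.single ℂ (fun _ => Fld 𝔤) i ∈ diffOps 𝔤}
  zero_mem' i := by rw [LinearMap.zero_comp]; exact zero_mem _
  add_mem' hr hs i := by rw [LinearMap.add_comp]; exact add_mem (hr i) (hs i)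
  smul_mem' c r hr i := by rw [LinearMap.smul_comp]; exact Subalgebra.smul_mem _ (hr i) c

variable {ι : Type*} [DecidableEq ι]

theorem proj_mem_rowDiffOps (j : ι) :
    (LinearMap.proj j : (ι → Fld 𝔤) →ₗ[ℂ] Fld 𝔤) ∈ rowDiffOps 𝔤 ι := fun i => by
  rcases eq_or_ne i j with rfl | h
  · rw [LinearMap.proj_comp_single_same]; exact one_mem (diffOps 𝔤)
  · rw [LinearMap.proj_comp_single_ne _ _ _ _ h.symm]; exact zero_mem _

theorem comp_mem_rowDiffOps {P : Module.End ℂ (Fld 𝔤)} (hP : P ∈ diffOps 𝔤)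
    {r : (ι → Fld 𝔤) →ₗ[ℂ] Fld 𝔤} (hr : r ∈ rowDiffOps 𝔤 ι) : P ∘ₗ r ∈ rowDiffOps 𝔤 ι :=
  fun i => mul_mem hP (hr i)

theorem del_mem_diffOps (k : Fin 2) : (del k : Module.End ℂ (Fld 𝔤)) ∈ diffOps 𝔤 :=
  Algebra.subset_adjoin (.inl (.inl (.inl ⟨k, rfl⟩)))

theorem delbar_mem_diffOps (k : Fin 2) : (delbar k : Module.End ℂ (Fld 𝔤)) ∈ diffOps 𝔤 :=
  Algebra.subset_adjoin (.inl (.inl (.inr ⟨k, rfl⟩)))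

end Rows

namespace BVData

variable {𝔤 : Type*} [AddCommGroup 𝔤] [Module ℂ 𝔤]

theorem isDiffOp_pi {X Y : BVData 𝔤} {r : Y.ι → X.Fields →ₗ[ℂ] Fld 𝔤}
    (hr : ∀ j, r j ∈ rowDiffOps 𝔤 X.ι) : IsDiffOp (X := X) (Y := Y) (LinearMap.pi r) :=
  fun j i => hr j i

/-- Testing the hypothesis on fields with a single component recovers the condition on matrix
entries. For an explicit row it becomes a conditional rewrite rule that kills each coordinate in the
row once its bidegree is checked. -/
theorem hasDegree_of {X Y : BVData 𝔤} {T : X.Fields →ₗ[ℂ] Y.Fields} {n : ℤ}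
    (hT : ∀ j x, (∀ i, Y.deg j = X.deg i + n ∧ Y.par j = X.par i → x i = 0) → T x j = 0) :
    HasDegree T n := by
  intro j i h
  by_contra hne
  refine h (LinearMap.ext fun m => hT j _ fun k hk' => ?_)
  rcases eq_or_ne k i with rfl | hk
  · exact absurd hk' hne
  · exact Pi.single_eq_of_ne (M := fun _ : X.ι => Fld 𝔤) hk m

theorem IsDiffOp.mem_compactFld {X Y : BVData 𝔤} {T : X.Fields →ₗ[ℂ] Y.Fields} (hT : IsDiffOp T)
    {x : X.Fields} (hx : ∀ i, x i ∈ compactFld 𝔤) (j : Y.ι) : T x j ∈ compactFld 𝔤 := by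
  have : x = ∑ i, Pi.single i (x i) := (Finset.univ_sum_single x).symm
  rw [this, map_sum, Finset.sum_apply]
  exact sum_mem fun i _ => diffOps_mem_compactFld (hT j i) (hx i)

/-- The pairing of `X` pairs the component `b` with the component `dual b`, by `c b` times `κ`. -/
structure PairedBy (X : BVData 𝔤) (κ : LinearMap.BilinForm ℂ 𝔤) (c : X.ι → ℂ) (dual : X.ι → X.ι) :
    Prop where
  pair_eq : ∀ x y, X.pair x y = ∑ b, c b • fldPair κ (x b) (y (dual b))
  dual_dual : Function.Involutive dual
  c_dual : ∀ b, c (dual b) = - c b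
  c_ne_zero : ∀ b, c b ≠ 0
  deg_dual : ∀ b, X.deg b + X.deg (dual b) = 1
  par_dual : ∀ b, X.par (dual b) = X.par b

namespace PairedBy

variable {X : BVData 𝔤} {κ : LinearMap.BilinForm ℂ 𝔤} {c : X.ι → ℂ} {dual : X.ι → X.ι}

theorem pair_mem_compactSupp (P : X.PairedBy κ c dual) {x : X.Fields}
    (hx : ∀ i, x i ∈ compactFld 𝔤) (y : X.Fields) :
    X.pair x y ∈ SmoothFn.compactSupp := by
  rw [P.pair_eq]
  exact sum_mem fun b _ => Submodule.smul_mem _ _ (hx b κ _)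

theorem mkQ_pair (P : X.PairedBy κ c dual) (x y : X.Fields) :
    SmoothFn.totalDerivs.mkQ (X.pair x y) = ∑ b, c b • intPair κ (x b) (y (dual b)) := by
  rw [P.pair_eq, map_sum]
  simp only [map_smul]; rfl

/-- When the pairing is governed by an involution of the components, antisymmetry, degree and
nondegeneracy hold by inspection of the coefficients. Only the differential operator and degree
conditions, square zero and one summed identity modulo total derivatives are left to check. -/
theorem isBVTheory [FiniteDimensional ℂ 𝔤] (P : X.PairedBy κ c dual) (hs : κ.IsSymm)
    (hκ : κ.Nondegenerate)
    (hD : IsDiffOp (X := X) (Y := X) X.d) (hdeg : HasDegree (X := X) (Y := X) X.d 1)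
    (hsq : ∀ x b, X.d (X.d x) b = 0) {sgn : X.ι → ℂ} (hsgn : ∀ b, X.sign b = sgn b)
    (hinv : ∀ x y : X.Fields, (∀ i, x i ∈ compactFld 𝔤) →
      ∑ b, (c b • intPair κ (X.d x b) (y (dual b)) +
        (sgn b * c b) • intPair κ (x b) (X.d y (dual b))) = 0) : X.IsBVTheory where
  diffOp := hD
  degree := hdeg
  sq_zero := LinearMap.ext fun x => funext fun b => hsq x b
  antisymm x y := by
    rw [P.pair_eq, P.pair_eq, ← Equiv.sum_comp (Function.Involutive.toPerm dual P.dual_dual),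
      ← Finset.sum_neg_distrib]
    refine Finset.sum_congr rfl fun b _ => ?_
    rw [Function.Involutive.coe_toPerm, P.dual_dual, P.c_dual, neg_smul, fldPair_symm hs]
  shifted i j m n h := by
    suffices j = dual i by subst this; exact ⟨P.deg_dual i, (P.par_dual i).symm⟩
    by_contra hj
    refine h ?_
    rw [P.pair_eq]
    refine Finset.sum_eq_zero fun b _ => ?_
    rcases eq_or_ne b i with rfl | hb
    · rw [Pi.single_eq_of_ne (M := fun _ : X.ι => Fld 𝔤) (Ne.symm hj), map_zero, smul_zero]
    · rw [Pi.single_eq_of_ne (M := fun _ : X.ι => Fld 𝔤) hb, map_zero, LinearMap.zero_apply,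
        smul_zero]
  nondegenerate x h := by
    funext b
    refine fldPair_nondegenerate hκ hs _ fun n => ?_
    -- A test field concentrated in the component `dual b` sees only the component `b` of `x`.
    have := h (Pi.single (dual b) n)
    rw [P.pair_eq, Finset.sum_eq_single b, Pi.single_eq_same] at this
    · exact (smul_eq_zero.1 this).resolve_left (P.c_ne_zero b)
    · intro b' _ hb'
      rw [Pi.single_eq_of_ne (M := fun _ : X.ι => Fld 𝔤), map_zero, smul_zero]
      exact fun h => hb' (by rw [← P.dual_dual b', h, P.dual_dual])
    · exact fun h => absurd (Finset.mem_univ b) h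
  invariant i m y hm := by
    have hx : ∀ j, (Pi.single i m : X.Fields) j ∈ compactFld 𝔤 := fun j => by
      rcases eq_or_ne j i with rfl | hj
      · rw [Pi.single_eq_same]; exact _root_.mem_compactFld hm
      · rw [Pi.single_eq_of_ne (M := fun _ : X.ι => Fld 𝔤) hj]; exact zero_mem _
    have h1 := P.pair_mem_compactSupp (hD.mem_compactFld hx) y
    have h2 := P.pair_mem_compactSupp hx (X.d y)
    rw [← SmoothFn.integralTop_smul _ h2,
      ← SmoothFn.integralTop_add h1 (Submodule.smul_mem _ _ h2)]
    refine SmoothFn.integralTop_eq_zero ?_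
    rw [← Submodule.Quotient.mk_eq_zero, ← Submodule.mkQ_apply, map_add, map_smul, P.mkQ_pair,
      P.mkQ_pair, Finset.smul_sum, ← Finset.sum_add_distrib, ← hinv _ y hx]
    -- The field on the left has only the component `i`, so the sign `sgn b` under the sum agrees
    -- with the constant factor `X.sign i`.
    refine Finset.sum_congr rfl fun b _ => ?_
    rcases eq_or_ne b i with rfl | hb
    · rw [smul_smul, hsgn]
    · rw [Pi.single_eq_of_ne (M := fun _ : X.ι => Fld 𝔤) hb, map_zero, LinearMap.zero_apply,
        smul_zero, smul_zero, smul_zero]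

end PairedBy

/-- A deformation retract is symplectic as soon as `p` is the adjoint of `i` modulo total
derivatives. -/
theorem DeformationRetract.isSymplectic_of {X₀ X : BVData 𝔤} (R : DeformationRetract X₀ X)
    {κ : LinearMap.BilinForm ℂ 𝔤} {c₀ : X₀.ι → ℂ} {dual₀ : X₀.ι → X₀.ι}
    (P₀ : X₀.PairedBy κ c₀ dual₀)
    {c : X.ι → ℂ} {dual : X.ι → X.ι} (P : X.PairedBy κ c dual)
    (h : ∀ a y, (∀ i, a i ∈ compactFld 𝔤) → ∑ b, c b • intPair κ (R.i a b) (y (dual b)) =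
      ∑ b, c₀ b • intPair κ (a b) (R.p y (dual₀ b))) : R.IsSymplectic := by
  have adj : ∀ a y, X₀.CompactSupp a →
      integralTop (X.pair (R.i a) y) = integralTop (X₀.pair a (R.p y)) := fun a y ha => by
    have ha' := fun i => _root_.mem_compactFld (ha i)
    refine SmoothFn.integralTop_congr (P.pair_mem_compactSupp (R.i_diffOp.mem_compactFld ha') y)
      (P₀.pair_mem_compactSupp ha' _) ?_
    rw [P.mkQ_pair, P₀.mkQ_pair, h a y ha']
  refine ⟨fun a b ha => ?_, adj⟩
  -- The isometry is the adjunction with `y = i b`, followed by `p ∘ i = id`.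
  rw [adj a _ ha]
  exact congrArg (fun x => integralTop (X₀.pair a x)) (LinearMap.congr_fun R.p_i b)

/-- A bijection of the components of two theories that matches all the data. -/
structure Reindexing (X Y : BVData 𝔤) where
  e : X.ι ≃ Y.ι
  deg : ∀ i, Y.deg (e i) = X.deg i
  par : ∀ i, Y.par (e i) = X.par i
  d : ∀ y i, Y.d y (e i) = X.d (y ∘ e) i
  pair : ∀ x y, Y.pair x y = X.pair (x ∘ e) (y ∘ e)

namespace Reindexing

variable {X Y X' Y' : BVData 𝔤} (f : Reindexing X Y) (f' : Reindexing X' Y')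

theorem sign (i : X.ι) : Y.sign (f.e i) = X.sign i := by
  rw [BVData.sign, BVData.sign, f.deg, f.par]

theorem single_comp (i : X.ι) (m : Fld 𝔤) :
    (Pi.single (f.e i) m : Y.Fields) ∘ f.e = Pi.single i m := by
  funext j
  rcases eq_or_ne j i with rfl | h
  · simp
  · simp [h]

theorem comp_injective {x y : Y.Fields} (h : x ∘ f.e = y ∘ f.e) : x = y :=
  f.e.surjective.injective_comp_right h

theorem d_comp (y : Y.Fields) : Y.d y ∘ f.e = X.d (y ∘ f.e) := funext (f.d y)

/-- The transport of an operator along reindexings. -/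
def transport (T : X.Fields →ₗ[ℂ] X'.Fields) : Y.Fields →ₗ[ℂ] Y'.Fields :=
  LinearMap.funLeft ℂ (Fld 𝔤) f'.e.symm ∘ₗ T ∘ₗ LinearMap.funLeft ℂ (Fld 𝔤) f.e

theorem transport_comp (T : X.Fields →ₗ[ℂ] X'.Fields) (y : Y.Fields) :
    f.transport f' T y ∘ f'.e = T (y ∘ f.e) := by
  funext j
  show T (y ∘ f.e) (f'.e.symm (f'.e j)) = _
  rw [Equiv.symm_apply_apply]

/-- The hypothesis says that `T` and `U` have the same matrix after relabelling, so conditions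
imposed entry by entry carry over. -/
theorem entry_eq {T : X.Fields →ₗ[ℂ] X'.Fields} {U : Y.Fields →ₗ[ℂ] Y'.Fields}
    (h : ∀ y, U y ∘ f'.e = T (y ∘ f.e)) (j : X'.ι) (i : X.ι) :
    entry U (f'.e j) (f.e i) = entry T j i := by
  refine LinearMap.ext fun m => ?_
  show (U (Pi.single (f.e i) m) ∘ f'.e) j = T (Pi.single i m) j
  rw [h, single_comp]

theorem isDiffOp {T : X.Fields →ₗ[ℂ] X'.Fields} {U : Y.Fields →ₗ[ℂ] Y'.Fields}
    (h : ∀ y, U y ∘ f'.e = T (y ∘ f.e)) (hT : IsDiffOp T) : IsDiffOp U := by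
  intro j i
  obtain ⟨j, rfl⟩ := f'.e.surjective j
  obtain ⟨i, rfl⟩ := f.e.surjective i
  rw [f.entry_eq f' h]
  exact hT j i

theorem hasDegree {T : X.Fields →ₗ[ℂ] X'.Fields} {U : Y.Fields →ₗ[ℂ] Y'.Fields}
    (h : ∀ y, U y ∘ f'.e = T (y ∘ f.e)) {n : ℤ} (hT : HasDegree T n) : HasDegree U n := by
  intro j i
  obtain ⟨j, rfl⟩ := f'.e.surjective j
  obtain ⟨i, rfl⟩ := f.e.surjective i
  rw [f.entry_eq f' h, f.deg, f.par, f'.deg, f'.par]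
  exact hT j i

theorem isBVTheory (f : Reindexing X Y) (h : X.IsBVTheory) : Y.IsBVTheory where
  diffOp := f.isDiffOp f f.d_comp h.diffOp
  degree := f.hasDegree f f.d_comp h.degree
  sq_zero := LinearMap.ext fun y => f.comp_injective <| by
    show Y.d (Y.d y) ∘ f.e = 0
    rw [d_comp, d_comp]
    exact LinearMap.congr_fun h.sq_zero _
  antisymm x y := by rw [f.pair, f.pair, h.antisymm]
  shifted i j m n := by
    obtain ⟨j, rfl⟩ := f.e.surjective j
    obtain ⟨i, rfl⟩ := f.e.surjective i
    rw [f.pair, f.single_comp, f.single_comp, f.deg, f.deg, f.par, f.par]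
    exact h.shifted i j m n
  nondegenerate x hx := f.comp_injective <| h.nondegenerate _ fun y => by
    have := hx (y ∘ f.e.symm)
    rw [f.pair] at this
    convert this
    funext i
    simp
  invariant i m y hm := by
    obtain ⟨i, rfl⟩ := f.e.surjective i
    rw [f.pair, f.pair, f.d_comp, f.d_comp, f.single_comp, f.sign]
    exact h.invariant i m _ hm

/-- The transport of a deformation retract along reindexings. -/
def retract (f₀ : Reindexing X' Y') (R : DeformationRetract X' X) : DeformationRetract Y' Y where
  i := f₀.transport f R.i
  p := f.transport f₀ R.p
  h := f.transport f R.h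
  i_diffOp := f₀.isDiffOp f (f₀.transport_comp f _) R.i_diffOp
  p_diffOp := f.isDiffOp f₀ (f.transport_comp f₀ _) R.p_diffOp
  h_diffOp := f.isDiffOp f (f.transport_comp f _) R.h_diffOp
  i_degree := f₀.hasDegree f (f₀.transport_comp f _) R.i_degree
  p_degree := f.hasDegree f₀ (f.transport_comp f₀ _) R.p_degree
  h_degree := f.hasDegree f (f.transport_comp f _) R.h_degree
  i_comm := LinearMap.ext fun y => f.comp_injective <| by
    rw [LinearMap.comp_apply, LinearMap.comp_apply, d_comp, transport_comp, transport_comp, d_comp]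
    exact LinearMap.congr_fun R.i_comm _
  p_comm := LinearMap.ext fun y => f₀.comp_injective <| by
    rw [LinearMap.comp_apply, LinearMap.comp_apply, d_comp, transport_comp, transport_comp, d_comp]
    exact LinearMap.congr_fun R.p_comm _
  p_i := LinearMap.ext fun y => f₀.comp_injective <| by
    rw [LinearMap.comp_apply, transport_comp, transport_comp]
    exact LinearMap.congr_fun R.p_i _
  homotopy := LinearMap.ext fun y => f.comp_injective <| by
    show f₀.transport f R.i (f.transport f₀ R.p y) ∘ f.e - y ∘ f.e =
      Y.d (f.transport f R.h y) ∘ f.e + f.transport f R.h (Y.d y) ∘ f.e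
    rw [d_comp, transport_comp, transport_comp, transport_comp, transport_comp, d_comp]
    exact LinearMap.congr_fun R.homotopy _

theorem isSymplectic (f₀ : Reindexing X' Y') {R : DeformationRetract X' X} (hR : R.IsSymplectic) :
    (f.retract f₀ R).IsSymplectic where
  isometry a b ha := by
    rw [f.pair, f₀.pair, retract, transport_comp, transport_comp]
    exact hR.isometry _ _ fun i => ha _
  adjoint a y ha := by
    rw [f.pair, f₀.pair, retract, transport_comp, transport_comp]
    exact hR.adjoint _ _ fun i => ha _

end Reindexing

end BVData

/-! ### Explicit models of the two theories -/

/-- An index set made of four kinds of blocks, the two middle ones occurring three times. -/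
inductive Blocks (A B C D : Type) : Type
  | vec (g : A)
  | scalar (a : Fin 3) (g : B)
  | scalarSt (a : Fin 3) (g : C)
  | vecSt (g : D)
  deriving DecidableEq, Fintype

namespace Blocks

variable {A B C D : Type}

/-- The index set as a disjoint union. -/
def equivSum : Blocks A B C D ≃ (A ⊕ D) ⊕ (Fin 3 × (B ⊕ C)) where
  toFun
    | vec g => .inl (.inl g)
    | vecSt g => .inl (.inr g)
    | scalar a g => .inr (a, .inl g)
    | scalarSt a g => .inr (a, .inr g)
  invFun
    | .inl (.inl g) => vec g
    | .inl (.inr g) => vecSt g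
    | .inr (a, .inl g) => scalar a g
    | .inr (a, .inr g) => scalarSt a g
  left_inv b := by cases b <;> rfl
  right_inv b := by rcases b with (_ | _) | ⟨_, _ | _⟩ <;> rfl

theorem sum_eq [Fintype A] [Fintype B] [Fintype C] [Fintype D] {M : Type*} [AddCommMonoid M]
    (f : Blocks A B C D → M) : ∑ b, f b = (∑ g, f (vec g) + ∑ g, f (vecSt g)) +
      ∑ a, (∑ g, f (scalar a g) + ∑ g, f (scalarSt a g)) := by
  rw [← Equiv.sum_comp equivSum.symm]
  simp only [Fintype.sum_sum_type, Fintype.sum_prod_type]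
  rfl

end Blocks

/-- The components of a Dolbeault form `u + u_k dz̄_k + u_{01} dz̄₁ ∧ dz̄₂`. -/
inductive Dolb : Type
  | o | b0 | b1 | b01
  deriving DecidableEq

instance : Fintype Dolb :=
  ⟨{.o, .b0, .b1, .b01},
    fun g => by cases g <;> simp⟩

/-- The components `Ω⁰ → Ω¹ → Ω²₊`, together with the components `S₋ → S₊` for the basis vector of
`W*` dual to `e₂`. -/
inductive VecIdx : Type
  | c | dz0 | dz1 | dzb0 | dzb1 | hol | anti | kah | lam0 | lam1 | chiSt0 | chiSt1
  deriving DecidableEq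

instance : Fintype VecIdx :=
  ⟨{.c, .dz0, .dz1, .dzb0, .dzb1, .hol, .anti, .kah, .lam0, .lam1, .chiSt0, .chiSt1},
    fun g => by cases g <;> simp⟩

/-- The components `S₋ → S₊` for a basis vector `w` of `W*` not dual to `e₂`, and the components
`Ω⁰ → Ω⁰` for `e₂* ∧ w`. -/
inductive ScalarIdx : Type
  | phi | phiSt | lam0 | lam1 | chiSt0 | chiSt1
  deriving DecidableEq

instance : Fintype ScalarIdx :=
  ⟨{.phi, .phiSt, .lam0, .lam1, .chiSt0, .chiSt1},
    fun g => by cases g <;> simp⟩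

/-- The components dual to those of `ScalarIdx`. -/
inductive ScalarStIdx : Type
  | chi0 | chi1 | lamSt0 | lamSt1 | phi | phiSt
  deriving DecidableEq

instance : Fintype ScalarStIdx :=
  ⟨{.chi0, .chi1, .lamSt0, .lamSt1, .phi, .phiSt},
    fun g => by cases g <;> simp⟩

/-- The components dual to those of `VecIdx`; `z k` and `zb k` are the coefficients of
`dz_k ∧ dz̄₁ ∧ dz̄₂` and `dz₁ ∧ dz₂ ∧ dz̄_k`. -/
inductive VecStIdx : Type
  | hol | anti | kah | z0 | z1 | zb0 | zb1 | cSt | chi0 | chi1 | lamSt0 | lamSt1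
  deriving DecidableEq

instance : Fintype VecStIdx :=
  ⟨{.hol, .anti, .kah, .z0, .z1, .zb0, .zb1, .cSt, .chi0, .chi1, .lamSt0, .lamSt1},
    fun g => by cases g <;> simp⟩

theorem Dolb.sum_eq {M : Type*} [AddCommMonoid M] (f : Dolb → M) :
    ∑ g, f g = f .o + (f .b0 + (f .b1 + f .b01)) := by
  rw [show (Finset.univ : Finset Dolb) = {.o, .b0, .b1, .b01} from rfl]
  simp [Finset.sum_insert]

theorem VecIdx.sum_eq {M : Type*} [AddCommMonoid M] (f : VecIdx → M) :
    ∑ g, f g = f .c + (f .dz0 + (f .dz1 + (f .dzb0 + (f .dzb1 + (f .hol + (f .anti + (f .kah +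
      (f .lam0 + (f .lam1 + (f .chiSt0 + f .chiSt1)))))))))) := by
  rw [show (Finset.univ : Finset VecIdx) = {.c, .dz0, .dz1, .dzb0, .dzb1, .hol, .anti, .kah,
    .lam0, .lam1, .chiSt0, .chiSt1} from rfl]
  simp [Finset.sum_insert]

theorem ScalarIdx.sum_eq {M : Type*} [AddCommMonoid M] (f : ScalarIdx → M) :
    ∑ g, f g = f .phi + (f .phiSt + (f .lam0 + (f .lam1 + (f .chiSt0 + f .chiSt1)))) := by
  rw [show (Finset.univ : Finset ScalarIdx) = {.phi, .phiSt, .lam0, .lam1, .chiSt0, .chiSt1} from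
    rfl]
  simp [Finset.sum_insert]

theorem ScalarStIdx.sum_eq {M : Type*} [AddCommMonoid M] (f : ScalarStIdx → M) :
    ∑ g, f g = f .chi0 + (f .chi1 + (f .lamSt0 + (f .lamSt1 + (f .phi + f .phiSt)))) := by
  rw [show (Finset.univ : Finset ScalarStIdx) = {.chi0, .chi1, .lamSt0, .lamSt1, .phi, .phiSt} from
    rfl]
  simp [Finset.sum_insert]

theorem VecStIdx.sum_eq {M : Type*} [AddCommMonoid M] (f : VecStIdx → M) :
    ∑ g, f g = f .hol + (f .anti + (f .kah + (f .z0 + (f .z1 + (f .zb0 + (f .zb1 + (f .cSt +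
      (f .chi0 + (f .chi1 + (f .lamSt0 + f .lamSt1)))))))))) := by
  rw [show (Finset.univ : Finset VecStIdx) = {.hol, .anti, .kah, .z0, .z1, .zb0, .zb1, .cSt,
    .chi0, .chi1, .lamSt0, .lamSt1} from rfl]
  simp [Finset.sum_insert]

/-- The components of holomorphic BF theory. -/
abbrev BFIdx : Type := Blocks Dolb Dolb Dolb Dolb

/-- The components of the twisted theory. -/
abbrev TwIdx : Type := Blocks VecIdx ScalarIdx ScalarStIdx VecStIdx

/-- The weight of the basis vectors of `W*` dual to `e₁, f₁, f₂`. -/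
def dualWt : Fin 3 → ℤ := ![1, 0, 0]

/-- The sign `(-1)^p` of the `(p, •)`-forms in the scalar blocks. -/
def formSign : Fin 3 → ℂ := ![1, -1, -1]

/-- The sign in the pairing of the scalar blocks. -/
def pairSign : Fin 3 → ℂ := ![1, 1, -1]

theorem formSign_mul_self (a : Fin 3) : formSign a * formSign a = 1 := by
  fin_cases a <;> simp [formSign]

theorem pairSign_ne_zero (a : Fin 3) : pairSign a ≠ 0 := by
  fin_cases a <;> simp [pairSign]

namespace Dolb

/-- The degree of a form. -/
def deg : Dolb → ℤ
  | o => 0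
  | b0 | b1 => 1
  | b01 => 2

/-- The complementary component. -/
def dual : Dolb → Dolb
  | o => b01
  | b0 => b1
  | b1 => b0
  | b01 => o

/-- The sign with which a component pairs with the complementary one. -/
def wedge : Dolb → ℂ
  | o | b0 | b01 => 1
  | b1 => -1

end Dolb

section Models

variable {𝔤 : Type*} [AddCommGroup 𝔤] [Module ℂ 𝔤]

open Blocks

/-- The pairing of the components `b` and `dual b`, with the coefficients `c b`. -/
def coeffPair {ι : Type*} [Fintype ι] (κ : LinearMap.BilinForm ℂ 𝔤) (c : ι → ℂ) (dual : ι → ι) :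
    (ι → Fld 𝔤) →ₗ[ℂ] (ι → Fld 𝔤) →ₗ[ℂ] SmoothFn :=
  ∑ b, c b • (fldPair κ).compl₁₂ (LinearMap.proj b) (LinearMap.proj (dual b))

theorem coeffPair_apply {ι : Type*} [Fintype ι] (κ : LinearMap.BilinForm ℂ 𝔤) (c : ι → ℂ)
    (dual : ι → ι) (x y : ι → Fld 𝔤) :
    coeffPair κ c dual x y = ∑ b, c b • fldPair κ (x b) (y (dual b)) := by
  simp only [coeffPair, LinearMap.sum_apply, LinearMap.smul_apply, LinearMap.compl₁₂_apply,
    LinearMap.proj_apply]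

/-- The linear maps from a space of fields to scalar fields. -/
abbrev Row (𝔤 ι : Type*) [AddCommGroup 𝔤] [Module ℂ 𝔤] : Type _ := (ι → Fld 𝔤) →ₗ[ℂ] Fld 𝔤

namespace Row

variable {ι : Type*}

/-- A component of a field. -/
def coord (b : ι) : Row 𝔤 ι := LinearMap.proj b

/-- A row followed by `∂/∂z_k`. -/
def del (k : Fin 2) (r : Row 𝔤 ι) : Row 𝔤 ι := _root_.del k ∘ₗ r

/-- A row followed by `∂/∂z̄_k`. -/
def delbar (k : Fin 2) (r : Row 𝔤 ι) : Row 𝔤 ι := _root_.delbar k ∘ₗ r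

theorem coord_apply (b : ι) (x : ι → Fld 𝔤) : coord b x = x b := rfl

theorem del_apply (k : Fin 2) (r : Row 𝔤 ι) (x : ι → Fld 𝔤) :
    del k r x = _root_.del k (r x) := rfl

theorem delbar_apply (k : Fin 2) (r : Row 𝔤 ι) (x : ι → Fld 𝔤) :
    delbar k r x = _root_.delbar k (r x) := rfl

end Row

/-- The components of the operator `s ∂̄` on Dolbeault forms. -/
def dolbRow {ι : Type*} (s : ℂ) (x : Dolb → Row 𝔤 ι) : Dolb → Row 𝔤 ι
  | .o => 0
  | .b0 => s • Row.delbar 0 (x .o)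
  | .b1 => s • Row.delbar 1 (x .o)
  | .b01 => s • (Row.delbar 0 (x .b1) - Row.delbar 1 (x .b0))

/-- The components of the differential of holomorphic BF theory. -/
def bfRow : BFIdx → Row 𝔤 BFIdx
  | vec g => dolbRow 1 (fun g => .coord (vec g)) g
  | scalar a g => dolbRow (formSign a) (fun g => .coord (scalar a g)) g
  | scalarSt a g => dolbRow (formSign a) (fun g => .coord (scalarSt a g)) g
  | vecSt g => dolbRow 1 (fun g => .coord (vecSt g)) g

/-- The component of holomorphic BF theory that pairs with a given one. -/
def bfDual : BFIdx → BFIdx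
  | vec g => vecSt g.dual
  | scalar a g => scalarSt a g.dual
  | scalarSt a g => scalar a g.dual
  | vecSt g => vec g.dual

/-- The coefficients of the pairing of holomorphic BF theory. -/
def bfCoeff : BFIdx → ℂ
  | vec g => Dolb.wedge g * (-1) ^ g.deg
  | scalar a g => - (pairSign a * Dolb.wedge g)
  | scalarSt a g => pairSign a * Dolb.wedge g.dual
  | vecSt g => - (Dolb.wedge g.dual * (-1) ^ g.dual.deg)

/-- The cohomological degree in holomorphic BF theory. -/
def bfDeg : BFIdx → ℤ
  | vec g => -1 + g.deg
  | scalar a g => dualWt a + -1 + g.deg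
  | scalarSt a g => -dualWt a + g.deg
  | vecSt g => g.deg

/-- The fermionic degree in holomorphic BF theory. -/
def bfPar : BFIdx → ZMod 2
  | vec _ | vecSt _ => 0
  | scalar a _ | scalarSt a _ => 1 + dualWt a

/-- The differential of holomorphic BF theory. -/
def bfD : (BFIdx → Fld 𝔤) →ₗ[ℂ] (BFIdx → Fld 𝔤) := LinearMap.pi bfRow

/-- Holomorphic BF theory, with its components in four kinds of blocks. -/
def bfModel (κ : LinearMap.BilinForm ℂ 𝔤) : BVData 𝔤 where
  ι := BFIdx
  deg := bfDeg
  par := bfPar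
  d := bfD
  pair := coeffPair κ bfCoeff bfDual

/-- The `vec` components of the differential of the twisted theory. -/
def twVec {ι : Type*} (x : VecIdx → Row 𝔤 ι) : VecIdx → Row 𝔤 ι
  | .c | .lam0 | .lam1 => 0
  | .dz0 => Row.del 0 (x .c) - x .lam0
  | .dz1 => Row.del 1 (x .c) - x .lam1
  | .dzb0 => Row.delbar 0 (x .c)
  | .dzb1 => Row.delbar 1 (x .c)
  | .hol =>
      Row.del 0 (x .dz1) - Row.del 1 (x .dz0) + x .chiSt0
  | .anti => Row.delbar 0 (x .dzb1) - Row.delbar 1 (x .dzb0)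
  | .kah => (1 / 2 : ℂ) • (Row.del 0 (x .dzb0) + Row.del 1 (x .dzb1)
      - Row.delbar 0 (x .dz0) - Row.delbar 1 (x .dz1) + x .chiSt1)
  | .chiSt0 => Row.del 0 (x .lam1) - Row.del 1 (x .lam0)
  | .chiSt1 => - (Row.delbar 0 (x .lam0) + Row.delbar 1 (x .lam1))

/-- The `scalar` components of the differential of the twisted theory. -/
def twScalar {ι : Type*} (s : ℂ) (x : ScalarIdx → Row 𝔤 ι) : ScalarIdx → Row 𝔤 ι
  | .phi => 0
  | .phiSt =>
      Row.del 0 (Row.delbar 0 (x .phi)) + Row.del 1 (Row.delbar 1 (x .phi))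
  | .lam0 => s • (Row.delbar 1 (x .phi))
  | .lam1 => - (s • (Row.delbar 0 (x .phi)))
  | .chiSt0 => Row.del 0 (x .lam1) - Row.del 1 (x .lam0)
      + s • x .phiSt
  | .chiSt1 =>
      - (Row.delbar 0 (x .lam0) + Row.delbar 1 (x .lam1))

/-- The `scalarSt` components of the differential of the twisted theory. -/
def twScalarSt {ι : Type*} (s : ℂ) (x : ScalarStIdx → Row 𝔤 ι) : ScalarStIdx → Row 𝔤 ι
  | .chi0 | .chi1 => 0
  | .lamSt0 =>
      - (Row.delbar 1 (x .chi0) + Row.del 0 (x .chi1))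
  | .lamSt1 =>
      Row.delbar 0 (x .chi0) - Row.del 1 (x .chi1)
  | .phi => s • x .chi1
  | .phiSt => Row.del 0 (Row.delbar 0 (x .phi))
      + Row.del 1 (Row.delbar 1 (x .phi)) + s •
        (Row.delbar 0 (x .lamSt0) + Row.delbar 1 (x .lamSt1))

/-- The `vecSt` components of the differential of the twisted theory. -/
def twVecSt {ι : Type*} (x : VecStIdx → Row 𝔤 ι) : VecStIdx → Row 𝔤 ι
  | .hol | .anti | .kah => 0
  | .z0 => Row.del 0 (x .anti) + Row.delbar 1 (x .kah)
  | .z1 => Row.del 1 (x .anti) - Row.delbar 0 (x .kah)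
  | .zb0 => Row.delbar 0 (x .hol) - Row.del 1 (x .kah)
  | .zb1 => Row.delbar 1 (x .hol) + Row.del 0 (x .kah)
  | .cSt => Row.del 0 (x .z1) - Row.del 1 (x .z0)
      + Row.delbar 0 (x .zb1) - Row.delbar 1 (x .zb0)
  | .chi0 => (x .kah)
  | .chi1 => (x .anti)
  | .lamSt0 => (x .z0)
      - (Row.delbar 1 (x .chi0) + Row.del 0 (x .chi1))
  | .lamSt1 => (x .z1)
      + (Row.delbar 0 (x .chi0) - Row.del 1 (x .chi1))

/-- The components of the differential of the twisted theory. -/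
def twRow : TwIdx → Row 𝔤 TwIdx
  | vec g => twVec (fun g => .coord (vec g)) g
  | scalar a g => twScalar (formSign a) (fun g => .coord (scalar a g)) g
  | scalarSt a g => twScalarSt (formSign a) (fun g => .coord (scalarSt a g)) g
  | vecSt g => twVecSt (fun g => .coord (vecSt g)) g

/-- The component of the twisted theory that pairs with a given one. -/
def twDual : TwIdx → TwIdx
  | vec .c => vecSt .cSt
  | vec .dz0 => vecSt .z1
  | vec .dz1 => vecSt .z0
  | vec .dzb0 => vecSt .zb1
  | vec .dzb1 => vecSt .zb0
  | vec .hol => vecSt .anti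
  | vec .anti => vecSt .hol
  | vec .kah => vecSt .kah
  | vec .lam0 => vecSt .lamSt1
  | vec .lam1 => vecSt .lamSt0
  | vec .chiSt0 => vecSt .chi1
  | vec .chiSt1 => vecSt .chi0
  | vecSt .cSt => vec .c
  | vecSt .z1 => vec .dz0
  | vecSt .z0 => vec .dz1
  | vecSt .zb1 => vec .dzb0
  | vecSt .zb0 => vec .dzb1
  | vecSt .anti => vec .hol
  | vecSt .hol => vec .anti
  | vecSt .kah => vec .kah
  | vecSt .lamSt1 => vec .lam0
  | vecSt .lamSt0 => vec .lam1
  | vecSt .chi1 => vec .chiSt0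
  | vecSt .chi0 => vec .chiSt1
  | scalar a .phi => scalarSt a .phiSt
  | scalar a .phiSt => scalarSt a .phi
  | scalar a .lam0 => scalarSt a .lamSt1
  | scalar a .lam1 => scalarSt a .lamSt0
  | scalar a .chiSt0 => scalarSt a .chi1
  | scalar a .chiSt1 => scalarSt a .chi0
  | scalarSt a .phiSt => scalar a .phi
  | scalarSt a .phi => scalar a .phiSt
  | scalarSt a .lamSt1 => scalar a .lam0
  | scalarSt a .lamSt0 => scalar a .lam1
  | scalarSt a .chi1 => scalar a .chiSt0
  | scalarSt a .chi0 => scalar a .chiSt1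

/-- The coefficients of the pairing of the twisted theory. -/
def twCoeff : TwIdx → ℂ
  | vec .c | vec .dz1 | vec .dzb1 | vec .hol | vec .anti | vec .lam0
  | vec .chiSt1 => -1
  | vec .dz0 | vec .dzb0 | vec .lam1 | vec .chiSt0 => 1
  | vec .kah => 2
  | vecSt .cSt | vecSt .z0 | vecSt .zb0 | vecSt .hol | vecSt .anti | vecSt .lamSt1
  | vecSt .chi0 => 1
  | vecSt .z1 | vecSt .zb1 | vecSt .lamSt0 | vecSt .chi1 => -1
  | vecSt .kah => -2
  | scalar a .phi | scalar a .lam0 | scalar a .chiSt1 => pairSign a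
  | scalar a .phiSt | scalar a .lam1 | scalar a .chiSt0 => - pairSign a
  | scalarSt a .phiSt | scalarSt a .lamSt1 | scalarSt a .chi0 => - pairSign a
  | scalarSt a .phi | scalarSt a .lamSt0 | scalarSt a .chi1 => pairSign a

/-- The cohomological degree in the twisted theory. -/
def twDeg : TwIdx → ℤ
  | vec .c | vec .lam0 | vec .lam1 => -1
  | vec .dz0 | vec .dz1 | vec .dzb0 | vec .dzb1 | vec .chiSt0 | vec .chiSt1 => 0
  | vec .hol | vec .anti | vec .kah => 1
  | vecSt .hol | vecSt .anti | vecSt .kah => 0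
  | vecSt .z0 | vecSt .z1 | vecSt .zb0 | vecSt .zb1 | vecSt .chi0 | vecSt .chi1 => 1
  | vecSt .cSt | vecSt .lamSt0 | vecSt .lamSt1 => 2
  | scalar a .phi => dualWt a + -1
  | scalar a .phiSt | scalar a .lam0 | scalar a .lam1 => dualWt a
  | scalar a .chiSt0 | scalar a .chiSt1 => dualWt a + 1
  | scalarSt a .chi0 | scalarSt a .chi1 => -dualWt a
  | scalarSt a .lamSt0 | scalarSt a .lamSt1 | scalarSt a .phi => -dualWt a + 1
  | scalarSt a .phiSt => -dualWt a + 2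

/-- The fermionic degree in the twisted theory. -/
def twPar : TwIdx → ZMod 2
  | vec _ | vecSt _ => 0
  | scalar a _ | scalarSt a _ => 1 + dualWt a

/-- The differential of the twisted theory. -/
def twD : (TwIdx → Fld 𝔤) →ₗ[ℂ] (TwIdx → Fld 𝔤) := LinearMap.pi twRow

/-- The twisted theory, with its components in four kinds of blocks. -/
def twModel (κ : LinearMap.BilinForm ℂ 𝔤) : BVData 𝔤 where
  ι := TwIdx
  deg := twDeg
  par := twPar
  d := twD
  pair := coeffPair κ twCoeff twDual

/-- The `vec` components of the inclusion of holomorphic BF theory into the twisted theory. -/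
def inclVec {ι : Type*} (x : Dolb → Row 𝔤 ι) : VecIdx → Row 𝔤 ι
  | .c => (x .o)
  | .dzb0 => (x .b0)
  | .dzb1 => (x .b1)
  | .anti => (x .b01)
  | .lam0 => Row.del 0 (x .o)
  | .lam1 => Row.del 1 (x .o)
  | .chiSt1 => - (Row.del 0 (x .b0) + Row.del 1 (x .b1))
  | _ => 0

/-- The `scalar` components of the inclusion of holomorphic BF theory into the twisted theory. -/
def inclScalar {ι : Type*} (s : ℂ) (x : Dolb → Row 𝔤 ι) : ScalarIdx → Row 𝔤 ι
  | .phi => (x .o)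
  | .lam0 => (x .b1)
  | .lam1 => - x .b0
  | .phiSt =>
      s • (Row.del 0 (x .b0) + Row.del 1 (x .b1))
  | .chiSt1 => - (s • x .b01)
  | .chiSt0 => 0

/-- The `scalarSt` components of the inclusion of holomorphic BF theory into the twisted theory. -/
def inclScalarSt {ι : Type*} (s : ℂ) (x : Dolb → Row 𝔤 ι) : ScalarStIdx → Row 𝔤 ι
  | .chi0 => s • x .o
  | .lamSt0 => - x .b1
  | .lamSt1 => (x .b0)
  | .phiSt => - x .b01
  | .chi1 | .phi => 0

/-- The `vecSt` components of the inclusion of holomorphic BF theory into the twisted theory. -/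
def inclVecSt {ι : Type*} (x : Dolb → Row 𝔤 ι) : VecStIdx → Row 𝔤 ι
  | .hol => - x .o
  | .zb0 => - x .b0
  | .zb1 => - x .b1
  | .cSt => - x .b01
  | _ => 0

/-- The components of the inclusion of holomorphic BF theory into the twisted theory. -/
def inclRow : TwIdx → Row 𝔤 BFIdx
  | vec g => inclVec (fun g => .coord (vec g)) g
  | scalar a g => inclScalar (formSign a) (fun g => .coord (scalar a g)) g
  | scalarSt a g => inclScalarSt (formSign a) (fun g => .coord (scalarSt a g)) g
  | vecSt g => inclVecSt (fun g => .coord (vecSt g)) g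

/-- The `vec` components of the projection of the twisted theory onto holomorphic BF theory. -/
def projVec {ι : Type*} (x : VecIdx → Row 𝔤 ι) : Dolb → Row 𝔤 ι
  | .o => (x .c)
  | .b0 => (x .dzb0)
  | .b1 => (x .dzb1)
  | .b01 => (x .anti)

/-- The `scalar` components of the projection of the twisted theory onto holomorphic BF theory. -/
def projScalar {ι : Type*} (s : ℂ) (x : ScalarIdx → Row 𝔤 ι) : Dolb → Row 𝔤 ι
  | .o => (x .phi)
  | .b0 => - x .lam1
  | .b1 => (x .lam0)
  | .b01 => - (s • x .chiSt1)

/-- The `scalarSt` components of the projection of the twisted theory onto holomorphic BF theory. -/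
def projScalarSt {ι : Type*} (s : ℂ) (x : ScalarStIdx → Row 𝔤 ι) : Dolb → Row 𝔤 ι
  | .o => s • x .chi0
  | .b0 => (x .lamSt1) + s • (Row.del 1 (x .phi))
  | .b1 => - x .lamSt0 - s • (Row.del 0 (x .phi))
  | .b01 => - x .phiSt

/-- The `vecSt` components of the projection of the twisted theory onto holomorphic BF theory. -/
def projVecSt {ι : Type*} (x : VecStIdx → Row 𝔤 ι) : Dolb → Row 𝔤 ι
  | .o => - x .hol
  | .b0 => - x .zb0 - Row.del 1 (x .chi0)
  | .b1 => - x .zb1 + Row.del 0 (x .chi0)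
  | .b01 => - x .cSt + Row.del 0 (x .lamSt1)
      - Row.del 1 (x .lamSt0)

/-- The components of the projection of the twisted theory onto holomorphic BF theory. -/
def projRow : BFIdx → Row 𝔤 TwIdx
  | vec g => projVec (fun g => .coord (vec g)) g
  | scalar a g => projScalar (formSign a) (fun g => .coord (scalar a g)) g
  | scalarSt a g => projScalarSt (formSign a) (fun g => .coord (scalarSt a g)) g
  | vecSt g => projVecSt (fun g => .coord (vecSt g)) g

/-- The `vec` components of the homotopy. -/
def homotopyVec {ι : Type*} (x : VecIdx → Row 𝔤 ι) : VecIdx → Row 𝔤 ι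
  | .lam0 => (x .dz0)
  | .lam1 => (x .dz1)
  | .chiSt0 => - x .hol
  | .chiSt1 => - (2 : ℂ) • x .kah
  | _ => 0

/-- The `scalar` components of the homotopy. -/
def homotopyScalar {ι : Type*} (s : ℂ) (x : ScalarIdx → Row 𝔤 ι) : ScalarIdx → Row 𝔤 ι
  | .phiSt => - (s • x .chiSt0)
  | _ => 0

/-- The `scalarSt` components of the homotopy. -/
def homotopyScalarSt {ι : Type*} (s : ℂ) (x : ScalarStIdx → Row 𝔤 ι) : ScalarStIdx → Row 𝔤 ι
  | .chi1 => - (s • x .phi)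
  | _ => 0

/-- The `vecSt` components of the homotopy. -/
def homotopyVecSt {ι : Type*} (x : VecStIdx → Row 𝔤 ι) : VecStIdx → Row 𝔤 ι
  | .kah => - x .chi0
  | .anti => - x .chi1
  | .z0 => - x .lamSt0
  | .z1 => - x .lamSt1
  | _ => 0

/-- The components of the homotopy. -/
def homotopyRow : TwIdx → Row 𝔤 TwIdx
  | vec g => homotopyVec (fun g => .coord (vec g)) g
  | scalar a g => homotopyScalar (formSign a) (fun g => .coord (scalar a g)) g
  | scalarSt a g => homotopyScalarSt (formSign a) (fun g => .coord (scalarSt a g)) g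
  | vecSt g => homotopyVecSt (fun g => .coord (vecSt g)) g

open BVData

/-- The inclusion of holomorphic BF theory into the twisted theory. -/
def inclMap : (BFIdx → Fld 𝔤) →ₗ[ℂ] (TwIdx → Fld 𝔤) := LinearMap.pi inclRow

/-- The projection of the twisted theory onto holomorphic BF theory. -/
def projMap : (TwIdx → Fld 𝔤) →ₗ[ℂ] (BFIdx → Fld 𝔤) := LinearMap.pi projRow

/-- The homotopy. -/
def homotopyMap : (TwIdx → Fld 𝔤) →ₗ[ℂ] (TwIdx → Fld 𝔤) := LinearMap.pi homotopyRow

/-! ### The cochain identities of the retract -/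

theorem bfD_apply (x : BFIdx → Fld 𝔤) (b : BFIdx) : bfD x b = bfRow b x := rfl

theorem twD_apply (x : TwIdx → Fld 𝔤) (b : TwIdx) : twD x b = twRow b x := rfl

theorem inclMap_apply (x : BFIdx → Fld 𝔤) (b : TwIdx) : inclMap x b = inclRow b x := rfl

theorem projMap_apply (x : TwIdx → Fld 𝔤) (b : BFIdx) : projMap x b = projRow b x := rfl

theorem homotopyMap_apply (x : TwIdx → Fld 𝔤) (b : TwIdx) :
    homotopyMap x b = homotopyRow b x := rfl

theorem formSign_smul_smul {M : Type*} [AddCommGroup M] [Module ℂ M] (a : Fin 3) (x : M) :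
    formSign a • formSign a • x = x := by rw [smul_smul, formSign_mul_self, one_smul]

theorem bfD_bfD (x : BFIdx → Fld 𝔤) (b : BFIdx) : bfD (bfD x) b = 0 := by
  rcases b with g | ⟨a, g⟩ | ⟨a, g⟩ | g <;> cases g <;>
    simp only [bfD_apply, bfRow, dolbRow, Row.coord_apply, Row.del_apply, Row.delbar_apply,
      LinearMap.add_apply, LinearMap.sub_apply, LinearMap.neg_apply, LinearMap.smul_apply,
      LinearMap.zero_apply, map_add, map_sub, map_neg, map_smul, map_zero, smul_sub, smul_zero,
      delbar_comm 1 0, sub_self]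

/-- Within a block `Q` leads from the row with `e₂*` to the row without it, so `Q² = 0`; the content
is that each row is a complex and that `Q` anticommutes with the row differentials. Moving `∂`
outside `∂̄` and ordering the indices brings all second and third order terms to a normal form,
after which the identity is linear. -/
theorem twD_twD (x : TwIdx → Fld 𝔤) (b : TwIdx) : twD (twD x) b = 0 := by
  rcases b with g | ⟨a, g⟩ | ⟨a, g⟩ | g <;> cases g <;>
    simp only [twD_apply, twRow, twVec, twVecSt, twScalar, twScalarSt, Row.coord_apply,
      Row.del_apply, Row.delbar_apply,
      LinearMap.add_apply, LinearMap.sub_apply, LinearMap.neg_apply, LinearMap.smul_apply,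
      LinearMap.zero_apply, map_add, map_sub, map_neg, map_smul, map_zero, smul_add, smul_sub,
      smul_neg, formSign_smul_smul, delbar_del, del_comm 1 0, delbar_comm 1 0] <;> module

theorem projMap_inclMap (x : BFIdx → Fld 𝔤) (b : BFIdx) : projMap (inclMap x) b = x b := by
  rcases b with g | ⟨a, g⟩ | ⟨a, g⟩ | g <;> cases g <;>
    simp only [projMap_apply, projRow, projVec, projScalar, projScalarSt, projVecSt, inclMap_apply,
      inclRow, inclVec, inclVecSt, inclScalar, inclScalarSt, Row.coord_apply,
      Row.del_apply, Row.delbar_apply,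
      LinearMap.add_apply, LinearMap.sub_apply, LinearMap.neg_apply, LinearMap.smul_apply,
      LinearMap.zero_apply, map_zero, smul_neg,
      formSign_smul_smul, neg_neg, smul_zero, add_zero, sub_zero]

/-- The derivative terms in the inclusion are forced here. In `vec` they make `Q` cancel the
`(1,0)`-part of `dc` and the `kah` part of `d₊A`; in `scalar`, the term in `phiSt` cancels the Dirac
operator in the row `chiSt0`. -/
theorem twD_inclMap (x : BFIdx → Fld 𝔤) (b : TwIdx) :
    twD (inclMap x) b = inclMap (bfD x) b := by
  rcases b with g | ⟨a, g⟩ | ⟨a, g⟩ | g <;> cases g <;>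
    simp only [twD_apply, twRow, twVec, twVecSt, twScalar, twScalarSt, bfD_apply, bfRow, dolbRow,
      inclMap_apply, inclRow, inclVec, inclVecSt, inclScalar, inclScalarSt, Row.coord_apply,
      Row.del_apply, Row.delbar_apply,
      LinearMap.add_apply, LinearMap.sub_apply, LinearMap.neg_apply, LinearMap.smul_apply,
      LinearMap.zero_apply, map_add, map_sub, map_neg, map_smul, map_zero, smul_add, smul_sub,
      smul_neg, formSign_smul_smul, delbar_del, del_comm 1 0, delbar_comm 1 0] <;> module

/-- Dually to the inclusion, the projection is corrected in `scalarSt` and `vecSt`, where the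
cancelled components `phi`, `chi0`, `lamSt0`, `lamSt1` feed into the surviving ones. -/
theorem bfD_projMap (x : TwIdx → Fld 𝔤) (b : BFIdx) :
    bfD (projMap x) b = projMap (twD x) b := by
  rcases b with g | ⟨a, g⟩ | ⟨a, g⟩ | g <;> cases g <;>
    simp only [twD_apply, twRow, twVec, twVecSt, twScalar, twScalarSt, bfD_apply, bfRow, dolbRow,
      projMap_apply, projRow, projVec, projVecSt, projScalar, projScalarSt, Row.coord_apply,
      Row.del_apply, Row.delbar_apply,
      LinearMap.add_apply, LinearMap.sub_apply, LinearMap.neg_apply, LinearMap.smul_apply,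
      LinearMap.zero_apply, map_add, map_sub, map_neg, map_smul, map_zero, smul_add, smul_sub,
      smul_neg, formSign_smul_smul, delbar_del, del_comm 1 0, delbar_comm 1 0] <;> module

/-- On the cancelled pairs `D h + h D` is minus the identity from the order-zero part of `Q`. The
remaining derivative terms are exactly the corrections of the inclusion and the projection. -/
theorem inclMap_projMap_sub (x : TwIdx → Fld 𝔤) (b : TwIdx) :
    inclMap (projMap x) b - x b = twD (homotopyMap x) b + homotopyMap (twD x) b := by
  rcases b with g | ⟨a, g⟩ | ⟨a, g⟩ | g <;> cases g <;>
    simp only [twD_apply, twRow, twVec, twVecSt, twScalar, twScalarSt,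
      projMap_apply, projRow, projVec, projVecSt, projScalar, projScalarSt,
      inclMap_apply, inclRow, inclVec, inclVecSt, inclScalar, inclScalarSt,
      homotopyMap_apply, homotopyRow, homotopyVec, homotopyVecSt, homotopyScalar, homotopyScalarSt,
      Row.coord_apply, Row.del_apply, Row.delbar_apply,
      LinearMap.add_apply, LinearMap.sub_apply, LinearMap.neg_apply, LinearMap.smul_apply,
      LinearMap.zero_apply, map_add, map_sub, map_neg, map_smul, map_zero, smul_add, smul_sub,
      smul_neg, formSign_smul_smul, delbar_del, del_comm 1 0, delbar_comm 1 0] <;> module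

/-! ### The operators are differential operators of the right degrees -/

namespace Row

variable {ι : Type*} [DecidableEq ι]

theorem coord_mem (b : ι) : (coord b : Row 𝔤 ι) ∈ rowDiffOps 𝔤 ι := proj_mem_rowDiffOps b

theorem del_mem (k : Fin 2) {r : Row 𝔤 ι} (hr : r ∈ rowDiffOps 𝔤 ι) :
    del k r ∈ rowDiffOps 𝔤 ι := comp_mem_rowDiffOps (del_mem_diffOps k) hr

theorem delbar_mem (k : Fin 2) {r : Row 𝔤 ι} (hr : r ∈ rowDiffOps 𝔤 ι) :
    delbar k r ∈ rowDiffOps 𝔤 ι := comp_mem_rowDiffOps (delbar_mem_diffOps k) hr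

end Row

theorem bfRow_mem (b : BFIdx) : (bfRow b : Row 𝔤 BFIdx) ∈ rowDiffOps 𝔤 BFIdx := by
  rcases b with g | ⟨a, g⟩ | ⟨a, g⟩ | g <;> cases g <;>
    simp (maxDischargeDepth := 8) only [bfRow, dolbRow, Row.coord_mem, Row.del_mem, Row.delbar_mem,
      add_mem, sub_mem, Submodule.neg_mem, Submodule.smul_mem, zero_mem]

theorem twRow_mem (b : TwIdx) : (twRow b : Row 𝔤 TwIdx) ∈ rowDiffOps 𝔤 TwIdx := by
  rcases b with g | ⟨a, g⟩ | ⟨a, g⟩ | g <;> cases g <;>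
    simp (maxDischargeDepth := 12) only [twRow, twVec, twVecSt, twScalar, twScalarSt,
      Row.coord_mem, Row.del_mem, Row.delbar_mem, add_mem, sub_mem, Submodule.neg_mem,
      Submodule.smul_mem, zero_mem]

theorem inclRow_mem (b : TwIdx) : (inclRow b : Row 𝔤 BFIdx) ∈ rowDiffOps 𝔤 BFIdx := by
  rcases b with g | ⟨a, g⟩ | ⟨a, g⟩ | g <;> cases g <;>
    simp (maxDischargeDepth := 12) only [inclRow, inclVec, inclVecSt, inclScalar, inclScalarSt,
      Row.coord_mem, Row.del_mem, Row.delbar_mem, add_mem, sub_mem, Submodule.neg_mem,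
      Submodule.smul_mem, zero_mem]

theorem projRow_mem (b : BFIdx) : (projRow b : Row 𝔤 TwIdx) ∈ rowDiffOps 𝔤 TwIdx := by
  rcases b with g | ⟨a, g⟩ | ⟨a, g⟩ | g <;> cases g <;>
    simp (maxDischargeDepth := 12) only [projRow, projVec, projVecSt, projScalar, projScalarSt,
      Row.coord_mem, Row.del_mem, Row.delbar_mem, add_mem, sub_mem, Submodule.neg_mem,
      Submodule.smul_mem, zero_mem]

theorem homotopyRow_mem (b : TwIdx) : (homotopyRow b : Row 𝔤 TwIdx) ∈ rowDiffOps 𝔤 TwIdx := by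
  rcases b with g | ⟨a, g⟩ | ⟨a, g⟩ | g <;> cases g <;>
    simp (maxDischargeDepth := 12) only [homotopyRow, homotopyVec, homotopyVecSt, homotopyScalar,
      homotopyScalarSt, Row.coord_mem, Submodule.neg_mem, Submodule.smul_mem, zero_mem]

theorem twRow_eq_zero (b : TwIdx) (x : TwIdx → Fld 𝔤)
    (hx : ∀ i, twDeg b = twDeg i + 1 ∧ twPar b = twPar i → x i = 0) : twRow b x = 0 := by
  rcases b with g | ⟨a, g⟩ | ⟨a, g⟩ | g <;> cases g <;>
    simp [twRow, twVec, twVecSt, twScalar, twScalarSt, Row.coord_apply, Row.del_apply,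
      Row.delbar_apply, hx, twDeg, twPar, add_assoc]

theorem bfRow_eq_zero (b : BFIdx) (x : BFIdx → Fld 𝔤)
    (hx : ∀ i, bfDeg b = bfDeg i + 1 ∧ bfPar b = bfPar i → x i = 0) : bfRow b x = 0 := by
  rcases b with g | ⟨a, g⟩ | ⟨a, g⟩ | g <;> cases g <;>
    simp [bfRow, dolbRow, Row.coord_apply, Row.del_apply,
      Row.delbar_apply, hx, bfDeg, bfPar, Dolb.deg, add_assoc]

theorem inclRow_eq_zero (b : TwIdx) (x : BFIdx → Fld 𝔤)
    (hx : ∀ i, twDeg b = bfDeg i + 0 ∧ twPar b = bfPar i → x i = 0) : inclRow b x = 0 := by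
  rcases b with g | ⟨a, g⟩ | ⟨a, g⟩ | g <;> cases g <;>
    simp [inclRow, inclVec, inclVecSt, inclScalar, inclScalarSt, Row.coord_apply, Row.del_apply,
      Row.delbar_apply, hx, twDeg, twPar, bfDeg, bfPar, Dolb.deg, add_assoc]

theorem projRow_eq_zero (b : BFIdx) (x : TwIdx → Fld 𝔤)
    (hx : ∀ i, bfDeg b = twDeg i + 0 ∧ bfPar b = twPar i → x i = 0) : projRow b x = 0 := by
  rcases b with g | ⟨a, g⟩ | ⟨a, g⟩ | g <;> cases g <;>
    simp [projRow, projVec, projVecSt, projScalar, projScalarSt, Row.coord_apply, Row.del_apply,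
      Row.delbar_apply, hx, twDeg, twPar, bfDeg, bfPar, Dolb.deg, add_assoc]

theorem homotopyRow_eq_zero (b : TwIdx) (x : TwIdx → Fld 𝔤)
    (hx : ∀ i, twDeg b = twDeg i + -1 ∧ twPar b = twPar i → x i = 0) : homotopyRow b x = 0 := by
  rcases b with g | ⟨a, g⟩ | ⟨a, g⟩ | g <;> cases g <;>
    simp [homotopyRow, homotopyVec, homotopyVecSt, homotopyScalar, homotopyScalarSt,
      Row.coord_apply, hx, twDeg, twPar, add_assoc]

theorem bfModel_diffOp (κ : LinearMap.BilinForm ℂ 𝔤) :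
    IsDiffOp (X := bfModel κ) (Y := bfModel κ) bfD :=
  isDiffOp_pi (X := bfModel κ) (Y := bfModel κ) bfRow_mem

theorem twModel_diffOp (κ : LinearMap.BilinForm ℂ 𝔤) :
    IsDiffOp (X := twModel κ) (Y := twModel κ) twD :=
  isDiffOp_pi (X := twModel κ) (Y := twModel κ) twRow_mem

/-- The retraction of the twisted theory onto holomorphic BF theory. -/
def modelRetract (κ : LinearMap.BilinForm ℂ 𝔤) : DeformationRetract (bfModel κ) (twModel κ) where
  i := inclMap
  p := projMap
  h := homotopyMap
  i_diffOp := isDiffOp_pi (X := bfModel κ) (Y := twModel κ) inclRow_mem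
  p_diffOp := isDiffOp_pi (X := twModel κ) (Y := bfModel κ) projRow_mem
  h_diffOp := isDiffOp_pi (X := twModel κ) (Y := twModel κ) homotopyRow_mem
  i_degree := hasDegree_of (X := bfModel κ) (Y := twModel κ) inclRow_eq_zero
  p_degree := hasDegree_of (X := twModel κ) (Y := bfModel κ) projRow_eq_zero
  h_degree := hasDegree_of (X := twModel κ) (Y := twModel κ) homotopyRow_eq_zero
  i_comm := LinearMap.ext fun x => funext (twD_inclMap x)
  p_comm := LinearMap.ext fun x => funext (bfD_projMap x)
  p_i := LinearMap.ext fun x => funext (projMap_inclMap x)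
  homotopy := LinearMap.ext fun x => funext (inclMap_projMap_sub x)

/-! ### The pairings -/

theorem bfModel_sum {M : Type*} [AddCommMonoid M] (κ : LinearMap.BilinForm ℂ 𝔤)
    (f : BFIdx → M) : ∑ b : (bfModel κ).ι, f b = ∑ b : BFIdx, f b := rfl

theorem bfModel_pairedBy (κ : LinearMap.BilinForm ℂ 𝔤) :
    (bfModel κ).PairedBy κ bfCoeff bfDual where
  pair_eq x y := (coeffPair_apply κ bfCoeff bfDual x y).trans (bfModel_sum κ _).symm
  dual_dual b := by rcases b with g | ⟨a, g⟩ | ⟨a, g⟩ | g <;> cases g <;> rfl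
  c_dual b := by
    rcases b with g | ⟨a, g⟩ | ⟨a, g⟩ | g <;> cases g <;>
      simp [bfDual, bfCoeff, Dolb.dual, Dolb.wedge, Dolb.deg]
  c_ne_zero b := by
    rcases b with g | ⟨a, g⟩ | ⟨a, g⟩ | g <;> cases g <;>
      simp [bfCoeff, Dolb.dual, Dolb.wedge, Dolb.deg, pairSign_ne_zero]
  deg_dual b := by
    show bfDeg _ + bfDeg _ = 1
    rcases b with g | ⟨a, g⟩ | ⟨a, g⟩ | g <;> cases g <;>
      simp only [bfDual, bfDeg, Dolb.dual, Dolb.deg] <;> ring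
  par_dual b := by rcases b with g | ⟨a, g⟩ | ⟨a, g⟩ | g <;> cases g <;> rfl

theorem twDual_twDual (b : TwIdx) : twDual (twDual b) = b := by
  rcases b with g | ⟨a, g⟩ | ⟨a, g⟩ | g <;> cases g <;> simp only [twDual]

theorem twCoeff_twDual (b : TwIdx) : twCoeff (twDual b) = - twCoeff b := by
  rcases b with g | ⟨a, g⟩ | ⟨a, g⟩ | g <;> cases g <;> simp only [twDual, twCoeff, neg_neg]

theorem twPar_twDual (b : TwIdx) : twPar (twDual b) = twPar b := by
  rcases b with g | ⟨a, g⟩ | ⟨a, g⟩ | g <;> cases g <;> simp only [twDual, twPar]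

theorem twModel_sum {M : Type*} [AddCommMonoid M] (κ : LinearMap.BilinForm ℂ 𝔤)
    (f : TwIdx → M) : ∑ b : (twModel κ).ι, f b = ∑ b : TwIdx, f b := rfl

theorem twModel_pairedBy (κ : LinearMap.BilinForm ℂ 𝔤) :
    (twModel κ).PairedBy κ twCoeff twDual where
  pair_eq x y := (coeffPair_apply κ twCoeff twDual x y).trans (twModel_sum κ _).symm
  dual_dual := twDual_twDual
  c_dual := twCoeff_twDual
  c_ne_zero b := by
    rcases b with g | ⟨a, g⟩ | ⟨a, g⟩ | g <;> cases g <;> simp [twCoeff, pairSign_ne_zero]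
  deg_dual b := by
    show twDeg _ + twDeg _ = 1
    rcases b with g | ⟨a, g⟩ | ⟨a, g⟩ | g <;> cases g <;> simp only [twDual, twDeg] <;> ring
  par_dual := twPar_twDual

/-- The signs of the components of holomorphic BF theory. -/
def bfSign : BFIdx → ℂ
  | vec .b0 | vec .b1 | scalar _ .o | scalar _ .b01 | scalarSt _ .b0 | scalarSt _ .b1
  | vecSt .o | vecSt .b01 => 1
  | _ => -1

/-- The signs of the components of the twisted theory. -/
def twSign : TwIdx → ℂ
  | vec .dz0 | vec .dz1 | vec .dzb0 | vec .dzb1 | vec .chiSt0 | vec .chiSt1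
  | scalar _ .phi | scalar _ .chiSt0 | scalar _ .chiSt1
  | scalarSt _ .lamSt0 | scalarSt _ .lamSt1 | scalarSt _ .phi
  | vecSt .hol | vecSt .anti | vecSt .kah | vecSt .cSt | vecSt .lamSt0 | vecSt .lamSt1 => 1
  | _ => -1

/-- Since `dualWt a` is `0` or `1`, this representative makes the weight drop out of degree plus
parity modulo `2`. Hence the signs in the scalar blocks do not depend on `a`. -/
theorem one_add_dualWt_val (a : Fin 3) : ((1 + dualWt a : ZMod 2).val : ℤ) = 1 - dualWt a := by
  fin_cases a <;> rfl

theorem bfModel_sign (κ : LinearMap.BilinForm ℂ 𝔤) (b : BFIdx) :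
    (bfModel κ).sign b = bfSign b := by
  show (-1 : ℂ) ^ (bfDeg b + ((bfPar b).val : ℤ)) = _
  rcases b with g | ⟨a, g⟩ | ⟨a, g⟩ | g
  · cases g <;> simp [bfDeg, bfPar, bfSign, Dolb.deg]
  · rw [bfPar, one_add_dualWt_val]
    fin_cases a <;> cases g <;> norm_num [bfDeg, bfSign, Dolb.deg, dualWt]
  · rw [bfPar, one_add_dualWt_val]
    fin_cases a <;> cases g <;> norm_num [bfDeg, bfSign, Dolb.deg, dualWt]
  · cases g <;> simp [bfDeg, bfPar, bfSign, Dolb.deg]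

theorem twModel_sign (κ : LinearMap.BilinForm ℂ 𝔤) (b : TwIdx) :
    (twModel κ).sign b = twSign b := by
  show (-1 : ℂ) ^ (twDeg b + ((twPar b).val : ℤ)) = _
  rcases b with g | ⟨a, g⟩ | ⟨a, g⟩ | g
  · cases g <;> simp [twDeg, twPar, twSign]
  · rw [twPar, one_add_dualWt_val]
    fin_cases a <;> cases g <;> norm_num [twDeg, twSign, dualWt]
  · rw [twPar, one_add_dualWt_val]
    fin_cases a <;> cases g <;> norm_num [twDeg, twSign, dualWt]
  · cases g <;> simp [twDeg, twPar, twSign]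

theorem bfModel_invariant (κ : LinearMap.BilinForm ℂ 𝔤) {x : BFIdx → Fld 𝔤}
    (hx : ∀ b, x b ∈ compactFld 𝔤) (y : BFIdx → Fld 𝔤) :
    ∑ b, (bfCoeff b • intPair κ (bfD x b) (y (bfDual b)) +
      (bfSign b * bfCoeff b) • intPair κ (x b) (bfD y (bfDual b))) = 0 := by
  simp only [Blocks.sum_eq, Dolb.sum_eq]
  -- The blocks `scalar a` and `scalarSt a` are dual to each other, so their contributions cancel
  -- for each `a` separately.
  rw [Finset.sum_eq_zero fun a _ => ?_]
  · simp only [bfSign, bfCoeff, bfDual, bfD_apply, bfRow, dolbRow, Dolb.dual, Dolb.wedge, Dolb.deg,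
      Row.coord_apply,
      Row.del_apply, Row.delbar_apply, LinearMap.add_apply, LinearMap.sub_apply,
      LinearMap.neg_apply, LinearMap.smul_apply, LinearMap.zero_apply, map_add, map_sub, map_neg,
      map_smul, map_zero, intPair_del, intPair_delbar, hx, del_mem_compactFld,
      delbar_mem_compactFld]
    module
  · simp only [bfSign, bfCoeff, bfDual, bfD_apply, bfRow, dolbRow, Dolb.dual, Dolb.wedge, Dolb.deg,
      Row.coord_apply,
      Row.del_apply, Row.delbar_apply, LinearMap.add_apply, LinearMap.sub_apply,
      LinearMap.neg_apply, LinearMap.smul_apply, LinearMap.zero_apply, map_add, map_sub, map_neg,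
      map_smul, map_zero, intPair_del, intPair_delbar, hx, del_mem_compactFld,
      delbar_mem_compactFld]
    module

/-- Up to signs, the differential is its own transpose: rows are exchanged with the dual rows, and
`Q` with itself. For example `phi → lam` is transposed to `lamSt → phiSt`, and `phiSt → chiSt0` to
`chi1 → phi`. -/
theorem twModel_invariant (κ : LinearMap.BilinForm ℂ 𝔤) {x : TwIdx → Fld 𝔤}
    (hx : ∀ b, x b ∈ compactFld 𝔤) (y : TwIdx → Fld 𝔤) :
    ∑ b, (twCoeff b • intPair κ (twD x b) (y (twDual b)) +
      (twSign b * twCoeff b) • intPair κ (x b) (twD y (twDual b))) = 0 := by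
  simp only [Blocks.sum_eq, VecIdx.sum_eq, ScalarIdx.sum_eq, ScalarStIdx.sum_eq, VecStIdx.sum_eq]
  rw [Finset.sum_eq_zero fun a _ => ?_]
  · simp only [twSign, twCoeff, twDual, twD_apply, twRow, twVec, twVecSt, Row.coord_apply,
      Row.del_apply, Row.delbar_apply, LinearMap.add_apply, LinearMap.sub_apply,
      LinearMap.neg_apply, LinearMap.smul_apply, LinearMap.zero_apply, map_add, map_sub, map_neg,
      map_smul, map_zero, intPair_del, intPair_delbar, hx, del_mem_compactFld,
      delbar_mem_compactFld]
    module
  -- Two integrations by parts reverse the order of the factors of the Laplacian, hence the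
  -- additional rule `delbar_del`.
  · simp only [twSign, twCoeff, twDual, twD_apply, twRow, twScalar, twScalarSt, Row.coord_apply,
      Row.del_apply, Row.delbar_apply, LinearMap.add_apply, LinearMap.sub_apply,
      LinearMap.neg_apply, LinearMap.smul_apply, LinearMap.zero_apply, map_add, map_sub, map_neg,
      map_smul, map_zero, intPair_del, intPair_delbar, hx, del_mem_compactFld,
      delbar_mem_compactFld, delbar_del]
    module

/-- The corrections of the inclusion in `vec` and `scalar` are transposed to those of the projection
in `vecSt` and `scalarSt`, the derivative `∂_k` being moved across the pairing. The uncorrected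
parts match because of the signs chosen in the two maps. -/
theorem inclMap_adjoint (κ : LinearMap.BilinForm ℂ 𝔤) {x : BFIdx → Fld 𝔤}
    (hx : ∀ b, x b ∈ compactFld 𝔤) (y : TwIdx → Fld 𝔤) :
    ∑ b, twCoeff b • intPair κ (inclMap x b) (y (twDual b)) =
      ∑ b, bfCoeff b • intPair κ (x b) (projMap y (bfDual b)) := by
  simp only [Blocks.sum_eq, VecIdx.sum_eq, ScalarIdx.sum_eq, ScalarStIdx.sum_eq, VecStIdx.sum_eq,
    Dolb.sum_eq]
  congr 1
  · simp only [twCoeff, twDual, bfCoeff, bfDual, Dolb.dual, Dolb.wedge, Dolb.deg,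
      inclMap_apply, inclRow, inclVec, inclVecSt, projMap_apply, projRow, projVec, projVecSt,
      Row.coord_apply,
      Row.del_apply, Row.delbar_apply, LinearMap.add_apply, LinearMap.sub_apply,
      LinearMap.neg_apply, LinearMap.smul_apply, LinearMap.zero_apply, map_add, map_sub, map_neg,
      map_smul, map_zero, intPair_del, intPair_delbar, hx, del_mem_compactFld,
      delbar_mem_compactFld]
    module
  · refine Finset.sum_congr rfl fun a _ => ?_
    simp only [twCoeff, twDual, bfCoeff, bfDual, Dolb.dual, Dolb.wedge, Dolb.deg,
      inclMap_apply, inclRow, inclScalar, inclScalarSt, projMap_apply, projRow, projScalar,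
      projScalarSt, Row.coord_apply,
      Row.del_apply, Row.delbar_apply, LinearMap.add_apply, LinearMap.sub_apply,
      LinearMap.neg_apply, LinearMap.smul_apply, LinearMap.zero_apply, map_add, map_sub, map_neg,
      map_smul, map_zero, intPair_del, intPair_delbar, hx, del_mem_compactFld,
      delbar_mem_compactFld]
    module

/-! ### The theorem for the models -/

theorem bfModel_isBVTheory [FiniteDimensional ℂ 𝔤] {κ : LinearMap.BilinForm ℂ 𝔤} (hs : κ.IsSymm)
    (hκ : κ.Nondegenerate) : (bfModel κ).IsBVTheory :=
  (bfModel_pairedBy κ).isBVTheory hs hκ (bfModel_diffOp κ)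
    (hasDegree_of (X := bfModel κ) (Y := bfModel κ) bfRow_eq_zero) bfD_bfD
    (bfModel_sign κ) fun _ y hx => (bfModel_sum κ _).trans (bfModel_invariant κ hx y)

theorem twModel_isBVTheory [FiniteDimensional ℂ 𝔤] {κ : LinearMap.BilinForm ℂ 𝔤} (hs : κ.IsSymm)
    (hκ : κ.Nondegenerate) : (twModel κ).IsBVTheory :=
  (twModel_pairedBy κ).isBVTheory hs hκ (twModel_diffOp κ)
    (hasDegree_of (X := twModel κ) (Y := twModel κ) twRow_eq_zero) twD_twD
    (twModel_sign κ) fun _ y hx => (twModel_sum κ _).trans (twModel_invariant κ hx y)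

theorem modelRetract_isSymplectic (κ : LinearMap.BilinForm ℂ 𝔤) : (modelRetract κ).IsSymplectic :=
  (modelRetract κ).isSymplectic_of (bfModel_pairedBy κ) (twModel_pairedBy κ) fun _ y ha =>
    (twModel_sum κ _).trans ((inclMap_adjoint κ ha y).trans (bfModel_sum κ _).symm)

/-! ### Differential forms in components -/

theorem insertSign_empty {n : ℕ} (a : Fin n) : insertSign a ∅ = 1 := by simp [insertSign]

theorem insertSign_zero_one : insertSign (0 : Fin 2) {1} = 1 := by
  rw [insertSign, show (({1} : Finset (Fin 2)).filter (· < 0)).card = 0 by decide, pow_zero]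

theorem insertSign_one_zero : insertSign (1 : Fin 2) {0} = -1 := by
  rw [insertSign, show (({0} : Finset (Fin 2)).filter (· < 1)).card = 1 by decide, pow_one]

theorem erase_pair_zero : ({0, 1} : Finset (Fin 2)).erase 0 = {1} := by decide

theorem erase_pair_one : ({0, 1} : Finset (Fin 2)).erase 1 = {0} := by decide

theorem delForm_empty (x : FormIdx → Fld 𝔤) (J : Finset (Fin 2)) : delForm x (∅, J) = 0 := by
  simp [delForm]

theorem delForm_singleton (x : FormIdx → Fld 𝔤) (k : Fin 2) (J : Finset (Fin 2)) :
    delForm x ({k}, J) = del k (x (∅, J)) := by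
  simp [delForm, insertSign_empty]

theorem delForm_pair (x : FormIdx → Fld 𝔤) (J : Finset (Fin 2)) :
    delForm x ({0, 1}, J) = del 0 (x ({1}, J)) - del 1 (x ({0}, J)) := by
  simp [delForm, erase_pair_zero, erase_pair_one, insertSign_zero_one, insertSign_one_zero,
    Finset.sum_pair, sub_eq_add_neg]

theorem delbarForm_empty (x : FormIdx → Fld 𝔤) (I : Finset (Fin 2)) : delbarForm x (I, ∅) = 0 := by
  simp [delbarForm]

theorem delbarForm_singleton (x : FormIdx → Fld 𝔤) (I : Finset (Fin 2)) (k : Fin 2) :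
    delbarForm x (I, {k}) = (-1 : ℂ) ^ I.card • delbar k (x (I, ∅)) := by
  simp [delbarForm, insertSign_empty]

theorem delbarForm_pair (x : FormIdx → Fld 𝔤) (I : Finset (Fin 2)) :
    delbarForm x (I, {0, 1}) =
      (-1 : ℂ) ^ I.card • (delbar 0 (x (I, {1})) - delbar 1 (x (I, {0}))) := by
  simp [delbarForm, erase_pair_zero, erase_pair_one, insertSign_zero_one, insertSign_one_zero,
    Finset.sum_pair, sub_eq_add_neg]

theorem dForm_apply (x : FormIdx → Fld 𝔤) (F : FormIdx) :
    dForm x F = delForm x F + delbarForm x F := rfl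

theorem formExt_of_eq {n : ℕ} (x : FormIdxOf n → Fld 𝔤) {F : FormIdx}
    (h : F.1.card + F.2.card = n) : formExt n x F = x ⟨F, h⟩ := by
  simp [formExt, h]

theorem formExt_of_ne {n : ℕ} (x : FormIdxOf n → Fld 𝔤) {F : FormIdx}
    (h : F.1.card + F.2.card ≠ n) : formExt n x F = 0 := by
  simp [formExt, h]

theorem sum_finset_two {M : Type*} [AddCommMonoid M] (f : Finset (Fin 2) → M) :
    ∑ I, f I = f ∅ + (f {0} + (f {1} + f {0, 1})) := by
  rw [show (Finset.univ : Finset (Finset (Fin 2))) = {∅, {0}, {1}, {0, 1}} by decide]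
  rw [Finset.sum_insert (by decide), Finset.sum_insert (by decide), Finset.sum_insert (by decide),
    Finset.sum_singleton]

theorem compl_singleton_zero : ({0} : Finset (Fin 2))ᶜ = {1} := by decide

theorem compl_singleton_one : ({1} : Finset (Fin 2))ᶜ = {0} := by decide

theorem compl_pair : ({0, 1} : Finset (Fin 2))ᶜ = ∅ := by decide

theorem compl_empty_eq_pair : (∅ : Finset (Fin 2))ᶜ = {0, 1} := by decide

theorem shuffleSign_eq {n : ℕ} (S : Finset (Fin n)) {k : ℕ}
    (h : ((S ×ˢ Sᶜ).filter (fun p => p.2 < p.1)).card = k) : shuffleSign S = (-1) ^ k := by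
  rw [shuffleSign, h]

theorem shuffleSign_empty : shuffleSign (∅ : Finset (Fin 2)) = 1 := by
  rw [shuffleSign_eq (k := 0) _ (by decide), pow_zero]

theorem shuffleSign_singleton_zero : shuffleSign ({0} : Finset (Fin 2)) = 1 := by
  rw [shuffleSign_eq (k := 0) _ (by decide), pow_zero]

theorem shuffleSign_singleton_one : shuffleSign ({1} : Finset (Fin 2)) = -1 := by
  rw [shuffleSign_eq (k := 1) _ (by decide), pow_one]

theorem shuffleSign_pair : shuffleSign ({0, 1} : Finset (Fin 2)) = 1 := by
  rw [shuffleSign_eq (k := 0) _ (by decide), pow_zero]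

/-! ### The model of holomorphic BF theory -/

/-- The set `J` of the form `dz̄_J`. -/
def Dolb.toFinset : Dolb → Finset (Fin 2)
  | o => ∅
  | b0 => {0}
  | b1 => {1}
  | b01 => {0, 1}

/-- The component of holomorphic BF theory with a given index in the model. -/
def bfIdx : BFIdx → Bool × FormIdx
  | vec g => (false, ∅, g.toFinset)
  | scalar a g => (![true, false, false] a, ![∅, {0}, {1}] a, g.toFinset)
  | scalarSt a g => (![false, true, true] a, ![{0, 1}, {1}, {0}] a, g.toFinset)
  | vecSt g => (true, {0, 1}, g.toFinset)

theorem bfIdx_bijective : Function.Bijective bfIdx := by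
  rw [Fintype.bijective_iff_injective_and_card]
  decide

theorem bfIdx_deg : ∀ i, ((bfIdx i).2.2.card : ℤ) - (if (bfIdx i).1 then 0 else 1) = bfDeg i := by
  decide

theorem bfIdx_par : ∀ i, ((bfIdx i).2.1.card : ZMod 2) = bfPar i := by decide

theorem bfPick_apply (ε : Bool) (y : Bool × FormIdx → Fld 𝔤) (F : FormIdx) :
    bfPick ε y F = y (ε, F) := rfl

/-- Moving `dz̄_j` past `dz_I` costs `(-1)^{|I|}`. This is `1` in `vec` and `vecSt`, where `I` is
empty or full, and `formSign a` in both scalar blocks, as complementary sets `I` have sizes of the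
same parity. -/
theorem delbarForm_bfPick (y : Bool × FormIdx → Fld 𝔤) (i : BFIdx) :
    delbarForm (bfPick (bfIdx i).1 y) (bfIdx i).2 = bfD (fun j => y (bfIdx j)) i := by
  rcases i with g | ⟨a, g⟩ | ⟨a, g⟩ | g
  · cases g <;> simp [bfIdx, Dolb.toFinset, bfD_apply, bfRow, dolbRow, delbarForm_empty,
      delbarForm_singleton, delbarForm_pair, Row.coord_apply, Row.delbar_apply, bfPick_apply]
  · fin_cases a <;> cases g <;> simp [bfIdx, Dolb.toFinset, bfD_apply, bfRow, dolbRow,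
      delbarForm_empty, delbarForm_singleton, delbarForm_pair, Row.coord_apply, Row.delbar_apply,
      formSign, bfPick_apply]
  · fin_cases a <;> cases g <;> simp [bfIdx, Dolb.toFinset, bfD_apply, bfRow, dolbRow,
      delbarForm_empty, delbarForm_singleton, delbarForm_pair, Row.coord_apply, Row.delbar_apply,
      formSign, bfPick_apply]
  · cases g <;> simp [bfIdx, Dolb.toFinset, bfD_apply, bfRow, dolbRow, delbarForm_empty,
      delbarForm_singleton, delbarForm_pair, Row.coord_apply, Row.delbar_apply, bfPick_apply]

theorem bfHalfPair_apply (κ : LinearMap.BilinForm ℂ 𝔤) (x y : Bool × FormIdx → Fld 𝔤) :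
    bfHalfPair κ x y = ∑ F : FormIdx, (wedgeSign F * (-1) ^ (F.1.card + F.2.card)) •
      fldPair κ (x (false, F)) (y (true, F.1ᶜ, F.2ᶜ)) := by
  simp [bfHalfPair, formPair, bfPick_apply, smul_smul]

/-- Each component occurs once on the left, in the first or in the second half pairing according to
its copy of `𝔤`. Symmetry of `κ` brings `x` to the first slot in both. -/
theorem bfHalfPair_sub {κ : LinearMap.BilinForm ℂ 𝔤} (hs : κ.IsSymm)
    (x y : Bool × FormIdx → Fld 𝔤) : bfHalfPair κ x y - bfHalfPair κ y x =
      ∑ b, bfCoeff b • fldPair κ (x (bfIdx b)) (y (bfIdx (bfDual b))) := by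
  simp only [bfHalfPair_apply, Fintype.sum_prod_type, sum_finset_two, Blocks.sum_eq, Dolb.sum_eq,
    Fin.sum_univ_three]
  simp only [bfDual, bfIdx, bfCoeff, Dolb.toFinset, Dolb.dual, Dolb.wedge,
    Dolb.deg, wedgeSign, compl_singleton_zero, compl_singleton_one, compl_pair, compl_empty_eq_pair,
    shuffleSign_empty, shuffleSign_singleton_zero, shuffleSign_singleton_one, shuffleSign_pair,
    pairSign, fldPair_symm hs (y _), Finset.card_empty, Finset.card_singleton,
    show ({0, 1} : Finset (Fin 2)).card = 2 from rfl, Matrix.cons_val]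
  norm_num
  abel

/-- The components of holomorphic BF theory correspond to those of the model. -/
def bfEquiv : BFIdx ≃ Bool × FormIdx := Equiv.ofBijective bfIdx bfIdx_bijective

theorem bfModel_pair (κ : LinearMap.BilinForm ℂ 𝔤) (x y : BFIdx → Fld 𝔤) :
    (bfModel κ).pair x y = ∑ b, bfCoeff b • fldPair κ (x b) (y (bfDual b)) :=
  coeffPair_apply κ bfCoeff bfDual x y

theorem holBF_pair (κ : LinearMap.BilinForm ℂ 𝔤) (x y : Bool × FormIdx → Fld 𝔤) :
    (holBF κ).pair x y = bfHalfPair κ x y - bfHalfPair κ y x := rfl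

theorem holBF_pair_eq {κ : LinearMap.BilinForm ℂ 𝔤} (hs : κ.IsSymm)
    (x y : Bool × FormIdx → Fld 𝔤) (x' y' : BFIdx → Fld 𝔤) (hx : ∀ b, x' b = x (bfIdx b))
    (hy : ∀ b, y' b = y (bfIdx b)) : (holBF κ).pair x y = (bfModel κ).pair x' y' := by
  rw [holBF_pair, bfHalfPair_sub hs, bfModel_pair]
  exact Finset.sum_congr rfl fun b _ => by rw [hx, hy]

/-- Holomorphic BF theory in terms of the model. -/
def bfReindexing {κ : LinearMap.BilinForm ℂ 𝔤} (hs : κ.IsSymm) :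
    Reindexing (bfModel κ) (holBF κ) where
  e := bfEquiv
  deg b := bfIdx_deg b
  par b := bfIdx_par b
  d y b := delbarForm_bfPick y b
  pair x y := holBF_pair_eq hs x y _ _ (fun _ => rfl) fun _ => rfl

/-! ### The model of the twisted theory -/

/-- The basis vectors `e₁, f₁, f₂` of `W`. -/
def wIdx : Fin 3 → Fin 4 := ![0, 2, 3]

namespace Lam

/-- The element `1` of `Λ⁰W*`. -/
def zero : Lam 0 := ⟨∅, rfl⟩

/-- The basis vector of `W*` dual to `e₂`. -/
def e : Lam 1 := ⟨{1}, rfl⟩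

/-- The basis vectors of `W*` dual to `e₁, f₁, f₂`. -/
def one (a : Fin 3) : Lam 1 := ⟨{wIdx a}, rfl⟩

/-- The basis vectors of `Λ²W*` that contain `e₂`. -/
def eOne (a : Fin 3) : Lam 2 := ⟨{1, wIdx a}, by fin_cases a <;> rfl⟩

/-- The basis vectors of `Λ²W*` that do not contain `e₂`. -/
def two (a : Fin 3) : Lam 2 := (eOne a).compl

/-- The basis vectors of `Λ³W*` that contain `e₂`. -/
def eTwo (a : Fin 3) : Lam 3 := (one a).compl

/-- The basis vector of `Λ³W*` that does not contain `e₂`. -/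
def three : Lam 3 := e.compl

/-- The basis vector of `Λ⁴W*`. -/
def top : Lam 4 := zero.compl

theorem univ_zero : (Finset.univ : Finset (Lam 0)) = {zero} := by decide
theorem univ_one : (Finset.univ : Finset (Lam 1)) = {e, one 0, one 1, one 2} := by decide
theorem univ_two : (Finset.univ : Finset (Lam 2)) =
    {eOne 0, eOne 1, eOne 2, two 0, two 1, two 2} := by decide
theorem univ_three : (Finset.univ : Finset (Lam 3)) = {three, eTwo 0, eTwo 1, eTwo 2} := by decide
theorem univ_top : (Finset.univ : Finset (Lam 4)) = {top} := by decide

end Lam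

open Lam

/-- The component of the twisted theory with a given index in the model. -/
def twIdx : TwIdx → SYMIdx
  | vec .c => .c zero
  | vec .dz0 => .A zero ⟨({0}, ∅), rfl⟩
  | vec .dz1 => .A zero ⟨({1}, ∅), rfl⟩
  | vec .dzb0 => .A zero ⟨(∅, {0}), rfl⟩
  | vec .dzb1 => .A zero ⟨(∅, {1}), rfl⟩
  | vec .hol => .BSt zero .hol
  | vec .anti => .BSt zero .anti
  | vec .kah => .BSt zero .kah
  | vec .lam0 => .lam e 0
  | vec .lam1 => .lam e 1
  | vec .chiSt0 => .chiSt e 0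
  | vec .chiSt1 => .chiSt e 1
  | scalar a .phi => .phi (eOne a)
  | scalar a .phiSt => .phiSt (eOne a)
  | scalar a .lam0 => .lam (one a) 0
  | scalar a .lam1 => .lam (one a) 1
  | scalar a .chiSt0 => .chiSt (one a) 0
  | scalar a .chiSt1 => .chiSt (one a) 1
  | scalarSt a .chi0 => .chi (eTwo a) 0
  | scalarSt a .chi1 => .chi (eTwo a) 1
  | scalarSt a .lamSt0 => .lamSt (eTwo a) 0
  | scalarSt a .lamSt1 => .lamSt (eTwo a) 1
  | scalarSt a .phi => .phi (two a)
  | scalarSt a .phiSt => .phiSt (two a)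
  | vecSt .hol => .B top .hol
  | vecSt .anti => .B top .anti
  | vecSt .kah => .B top .kah
  | vecSt .z0 => .ASt top ⟨({0}, {0, 1}), rfl⟩
  | vecSt .z1 => .ASt top ⟨({1}, {0, 1}), rfl⟩
  | vecSt .zb0 => .ASt top ⟨({0, 1}, {0}), rfl⟩
  | vecSt .zb1 => .ASt top ⟨({0, 1}, {1}), rfl⟩
  | vecSt .cSt => .cSt top
  | vecSt .chi0 => .chi three 0
  | vecSt .chi1 => .chi three 1
  | vecSt .lamSt0 => .lamSt three 0
  | vecSt .lamSt1 => .lamSt three 1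

theorem twIdx_deg : ∀ b, (twIdx b).deg + holTwist.weight (twIdx b) = twDeg b := by decide

theorem twIdx_par : ∀ b, (twIdx b).par + (holTwist.weight (twIdx b) : ZMod 2) = twPar b := by
  decide

set_option maxRecDepth 20000 in
theorem twIdx_surjective : Function.Surjective twIdx := by
  -- The basis of each `Λ^k W*` is divided into the vectors with and without `e₂*`, which are the
  -- two rows of the blocks.
  have h0 : ∀ S : Lam 0, S = zero := by decide
  have h1 : ∀ S : Lam 1, S = e ∨ ∃ a, S = one a := by decide
  have h2 : ∀ S : Lam 2, (∃ a, S = eOne a) ∨ ∃ a, S = two a := by decide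
  have h3 : ∀ S : Lam 3, S = three ∨ ∃ a, S = eTwo a := by decide
  have h4 : ∀ S : Lam 4, S = top := by decide
  rintro (S | ⟨S, F⟩ | ⟨S, s⟩ | ⟨S, i⟩ | ⟨S, C⟩ | S | S | ⟨S, C⟩ | ⟨S, i⟩ | ⟨S, s⟩ | ⟨S, F⟩ | S)
  · rw [h0 S]; exact ⟨vec .c, rfl⟩
  · rw [h0 S]; revert F; decide
  · rw [h0 S]
    cases s
    exacts [⟨vec .hol, rfl⟩, ⟨vec .anti, rfl⟩, ⟨vec .kah, rfl⟩]
  · obtain rfl | ⟨a, rfl⟩ := h1 S <;> fin_cases i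
    exacts [⟨vec .lam0, rfl⟩, ⟨vec .lam1, rfl⟩, ⟨scalar a .lam0, rfl⟩, ⟨scalar a .lam1, rfl⟩]
  · obtain rfl | ⟨a, rfl⟩ := h1 S <;> fin_cases C
    exacts [⟨vec .chiSt0, rfl⟩, ⟨vec .chiSt1, rfl⟩, ⟨scalar a .chiSt0, rfl⟩,
      ⟨scalar a .chiSt1, rfl⟩]
  · obtain ⟨a, rfl⟩ | ⟨a, rfl⟩ := h2 S
    exacts [⟨scalar a .phi, rfl⟩, ⟨scalarSt a .phi, rfl⟩]
  · obtain ⟨a, rfl⟩ | ⟨a, rfl⟩ := h2 S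
    exacts [⟨scalar a .phiSt, rfl⟩, ⟨scalarSt a .phiSt, rfl⟩]
  · obtain rfl | ⟨a, rfl⟩ := h3 S <;> fin_cases C
    exacts [⟨vecSt .chi0, rfl⟩, ⟨vecSt .chi1, rfl⟩, ⟨scalarSt a .chi0, rfl⟩,
      ⟨scalarSt a .chi1, rfl⟩]
  · obtain rfl | ⟨a, rfl⟩ := h3 S <;> fin_cases i
    exacts [⟨vecSt .lamSt0, rfl⟩, ⟨vecSt .lamSt1, rfl⟩, ⟨scalarSt a .lamSt0, rfl⟩,
      ⟨scalarSt a .lamSt1, rfl⟩]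
  · rw [h4 S]
    cases s
    exacts [⟨vecSt .hol, rfl⟩, ⟨vecSt .anti, rfl⟩, ⟨vecSt .kah, rfl⟩]
  · rw [h4 S]; revert F; decide
  · rw [h4 S]; exact ⟨vecSt .cSt, rfl⟩

set_option maxRecDepth 20000 in
theorem twIdx_injective : Function.Injective twIdx := by
  decide

/-! ### Contraction with `e₂` on the basis of `ΛW*` -/

section Contraction

variable {N : Type*} [AddCommGroup N] [Module ℂ N]

theorem contr_single_of_mem {k : ℕ} (x : Lam (k + 1) → N) {a : Fin 4} {S : Lam k} (h : a ∈ S.1) :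
    contr (Pi.single a 1) x S = 0 := by
  refine Finset.sum_eq_zero fun b _ => ?_
  split_ifs with hb
  · rfl
  · rw [Pi.single_eq_of_ne (by rintro rfl; exact hb h), mul_zero, zero_smul]

theorem contr_single {k : ℕ} (x : Lam (k + 1) → N) {a : Fin 4} {S : Lam k} (h : a ∉ S.1)
    {T : Lam (k + 1)} (hT : T.1 = insert a S.1) {n : ℕ}
    (hn : (S.1.filter (fun b => b < a)).card = n) :
    contr (Pi.single a 1) x S = (-1 : ℂ) ^ n • x T := by
  rw [contr, Finset.sum_eq_single a, dif_pos h, Pi.single_eq_same, mul_one, insertSign, hn]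
  · congr 2
    exact Subtype.ext hT.symm
  · intro b _ hb
    split_ifs
    · rfl
    · rw [Pi.single_eq_of_ne hb, mul_zero, zero_smul]
  · exact fun h' => absurd (Finset.mem_univ a) h'

theorem contr_zero (x : Lam (0 + 1) → N) : contr holTwist.w x zero = x e :=
  (contr_single x (by decide) rfl (n := 0) rfl).trans (by rw [pow_zero, one_smul])

theorem contr_e (x : Lam (1 + 1) → N) : contr holTwist.w x e = 0 :=
  contr_single_of_mem x (by decide)

/-- Among the other basis vectors only `e₁` precedes `e₂`, so the sign is `-1` for `a = 0` alone.
Thus `formSign`, the sign of `∂̄` on the forms in these blocks, also records the contraction. -/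
theorem contr_one (x : Lam (1 + 1) → N) (a : Fin 3) :
    contr holTwist.w x (one a) = - (formSign a • x (eOne a)) := by
  fin_cases a
  · exact (contr_single x (by decide) (T := eOne 0) (by decide) (n := 1) rfl).trans
      (by simp [formSign])
  · exact (contr_single x (by decide) (T := eOne 1) (by decide) (n := 0) rfl).trans
      (by simp [formSign])
  · exact (contr_single x (by decide) (T := eOne 2) (by decide) (n := 0) rfl).trans
      (by simp [formSign])

theorem contr_eOne (x : Lam (2 + 1) → N) (a : Fin 3) : contr holTwist.w x (eOne a) = 0 :=
  contr_single_of_mem x (by revert a; decide)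

/-- The set `two a` contains `e₁` exactly when `a ≠ 0`, and `e₁` is the only vector that `e₂` has to
pass. -/
theorem contr_two (x : Lam (2 + 1) → N) (a : Fin 3) :
    contr holTwist.w x (two a) = formSign a • x (eTwo a) := by
  fin_cases a
  · exact (contr_single x (by decide) (T := eTwo 0) (by decide) (n := 0) (by decide)).trans
      (by simp [formSign])
  · exact (contr_single x (by decide) (T := eTwo 1) (by decide) (n := 1) (by decide)).trans
      (by simp [formSign])
  · exact (contr_single x (by decide) (T := eTwo 2) (by decide) (n := 1) (by decide)).trans
      (by simp [formSign])

theorem contr_three (x : Lam (3 + 1) → N) : contr holTwist.w x three = - x top :=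
  (contr_single x (by decide) (T := top) (by decide) (n := 1) (by decide)).trans (by simp)

theorem contr_eTwo (x : Lam (3 + 1) → N) (a : Fin 3) : contr holTwist.w x (eTwo a) = 0 :=
  contr_single_of_mem x (by revert a; decide)

end Contraction

/-! ### The twisted differential, one kind of component at a time -/

section Differential

variable (y : SYMFields 𝔤)

theorem pick_apply {K : Type} (f : K → SYMIdx) (k : K) : pick f y k = y (f k) := rfl

theorem comp_apply (t : SYMIdx) : comp t y = y t := rfl

/-- The differential of the holomorphic twist. -/
def holTwistD : SYMFields 𝔤 →ₗ[ℂ] SYMFields 𝔤 := symD + symQ holTwist.α holTwist.w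

theorem holTwistD_c (S : Lam 0) : holTwistD y (.c S) = 0 + 0 := rfl

theorem holTwistD_A (S : Lam 0) (F : FormIdxOf 1) : holTwistD y (.A S F) =
    dForm (formExt 0 (pick (fun _ => .c S) y)) F.1 + - tensorOne holTwist.α
      (contr holTwist.w (fun T => pick (𝔤 := 𝔤) (.lam T)) S y) F.1 := rfl

theorem holTwistD_BSt (S : Lam 0) (s : SD) : holTwistD y (.BSt S s) =
    sdProj (dForm (formExt 1 (pick (.A S) y))) s + tensorTwo holTwist.α
      (contr holTwist.w (fun T => pick (𝔤 := 𝔤) (.chiSt T)) S y) s := rfl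

theorem holTwistD_lam (S : Lam 1) (i : Fin 2) : holTwistD y (.lam S i) =
    0 + dAlphaUp holTwist.α (contr holTwist.w (fun T => comp (𝔤 := 𝔤) (.phi T)) S y) i := rfl

theorem holTwistD_chiSt (S : Lam 1) (C : Fin 2) : holTwistD y (.chiSt S C) =
    diracMinus (pick (.lam S) y) C + - tensorZero holTwist.α
      (contr holTwist.w (fun T => comp (𝔤 := 𝔤) (.phiSt T)) S y) C := rfl

theorem holTwistD_phi (S : Lam 2) : holTwistD y (.phi S) =
    0 + - contrOne holTwist.α (contr holTwist.w (fun T => pick (𝔤 := 𝔤) (.chi T)) S y) := rfl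

theorem holTwistD_phiSt (S : Lam 2) : holTwistD y (.phiSt S) =
    lap (y (.phi S)) + dAlphaDown holTwist.α
      (contr holTwist.w (fun T => pick (𝔤 := 𝔤) (.lamSt T)) S y) := rfl

theorem holTwistD_chi (S : Lam 3) (C : Fin 2) : holTwistD y (.chi S C) =
    0 + contrTwo holTwist.α (contr holTwist.w (fun T => pick (𝔤 := 𝔤) (.B T)) S y) C := rfl

theorem holTwistD_lamSt (S : Lam 3) (i : Fin 2) : holTwistD y (.lamSt S i) =
    diracPlus (pick (.chi S) y) i + - contrThree holTwist.α (formExt 3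
      (contr holTwist.w (fun T => pick (𝔤 := 𝔤) (.ASt T)) S y)) i := rfl

theorem holTwistD_B (S : Lam 4) (s : SD) : holTwistD y (.B S s) = 0 + 0 := rfl

theorem holTwistD_ASt (S : Lam 4) (F : FormIdxOf 3) : holTwistD y (.ASt S F) =
    dForm (sdIncl (pick (.B S) y)) F.1 + 0 := rfl

theorem holTwistD_cSt (S : Lam 4) : holTwistD y (.cSt S) =
    dForm (formExt 3 (pick (.ASt S) y)) (Finset.univ, Finset.univ) + 0 := rfl

theorem univ_eq_pair : (Finset.univ : Finset (Fin 2)) = {0, 1} := by decide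

theorem holTwist_α_zero : holTwist.α 0 = 1 := rfl

theorem holTwist_α_one : holTwist.α 1 = 0 := rfl

theorem sdProj_hol (x : FormIdx → Fld 𝔤) : sdProj x .hol = x ({0, 1}, ∅) := rfl
theorem sdProj_anti (x : FormIdx → Fld 𝔤) : sdProj x .anti = x (∅, {0, 1}) := rfl
theorem sdProj_kah (x : FormIdx → Fld 𝔤) :
    sdProj x .kah = (1 / 2 : ℂ) • (x ({0}, {0}) + x ({1}, {1})) := rfl

theorem sdIncl_hol (x : SD → Fld 𝔤) : sdIncl x ({0, 1}, ∅) = x .hol := rfl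
theorem sdIncl_anti (x : SD → Fld 𝔤) : sdIncl x (∅, {0, 1}) = x .anti := rfl
theorem sdIncl_zero_zero (x : SD → Fld 𝔤) : sdIncl x ({0}, {0}) = x .kah := rfl
theorem sdIncl_one_one (x : SD → Fld 𝔤) : sdIncl x ({1}, {1}) = x .kah := rfl
theorem sdIncl_zero_one (x : SD → Fld 𝔤) : sdIncl x ({0}, {1}) = 0 := rfl
theorem sdIncl_one_zero (x : SD → Fld 𝔤) : sdIncl x ({1}, {0}) = 0 := rfl
theorem sdIncl_of_card_ne (x : SD → Fld 𝔤) (F : FormIdx) (h : F.1.card + F.2.card ≠ 2) :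
    sdIncl x F = 0 := by
  rw [sdIncl, LinearMap.pi_apply, if_neg (by rintro rfl; exact h rfl),
    if_neg (by rintro rfl; exact h rfl),
    if_neg (by rintro (rfl | rfl) <;> exact h rfl), LinearMap.zero_apply]

end Differential

/-- With `α = α₁` only `α 0 = 1` survives in the spinor maps, and the contraction picks a single
basis vector or vanishes. Each component of `d + Q` thereby reduces to a row inside one block. -/
theorem holTwistD_twIdx (y : SYMFields 𝔤) (b : TwIdx) :
    holTwistD y (twIdx b) = twD (fun j => y (twIdx j)) b := by
  rw [twD_apply]
  rcases b with g | ⟨a, g⟩ | ⟨a, g⟩ | g <;> cases g <;>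
    simp only [twIdx, twRow, twVec, twScalar, twScalarSt, twVecSt]
  all_goals
    simp [holTwistD_c, holTwistD_A, holTwistD_BSt, holTwistD_lam, holTwistD_chiSt, holTwistD_phi,
      holTwistD_phiSt, holTwistD_chi, holTwistD_lamSt, holTwistD_B, holTwistD_ASt, holTwistD_cSt,
      contr_zero, contr_e, contr_one, contr_eOne, contr_two, contr_three, contr_eTwo,
      tensorZero, tensorOne, tensorTwo, contrOne, contrTwo, contrThree, dAlphaUp, dAlphaDown,
      diracMinus, diracPlus, spinDel, lap, sdProj_hol, sdProj_anti, sdProj_kah,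
      holTwist_α_zero, holTwist_α_one, univ_eq_pair, dForm_apply, delForm_empty, delForm_singleton,
      delForm_pair, delbarForm_empty, delbarForm_singleton, delbarForm_pair, formExt_of_eq,
      formExt_of_ne, sdIncl_hol, sdIncl_anti, sdIncl_zero_zero, sdIncl_one_one, sdIncl_zero_one,
      sdIncl_one_zero, sdIncl_of_card_ne, pick_apply, comp_apply, Row.coord_apply, Row.del_apply,
      Row.delbar_apply, twIdx]
  all_goals try module

/-! ### Sums and shuffle signs over the basis of `ΛW*` -/

namespace Lam

theorem sum_zero {M : Type*} [AddCommMonoid M] (f : Lam 0 → M) : ∑ S, f S = f zero := by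
  rw [univ_zero, Finset.sum_singleton]

theorem sum_one {M : Type*} [AddCommMonoid M] (f : Lam 1 → M) :
    ∑ S, f S = f e + ∑ a, f (one a) := by
  rw [univ_one, Finset.sum_insert (by decide), Finset.sum_insert (by decide),
    Finset.sum_insert (by decide), Finset.sum_singleton, Fin.sum_univ_three, add_assoc]

theorem sum_two {M : Type*} [AddCommMonoid M] (f : Lam 2 → M) :
    ∑ S, f S = ∑ a, f (eOne a) + ∑ a, f (two a) := by
  rw [univ_two, Finset.sum_insert (by decide), Finset.sum_insert (by decide),
    Finset.sum_insert (by decide), Finset.sum_insert (by decide), Finset.sum_insert (by decide),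
    Finset.sum_singleton, Fin.sum_univ_three, Fin.sum_univ_three, add_assoc, add_assoc, add_assoc]

theorem sum_three {M : Type*} [AddCommMonoid M] (f : Lam 3 → M) :
    ∑ S, f S = f three + ∑ a, f (eTwo a) := by
  rw [univ_three, Finset.sum_insert (by decide), Finset.sum_insert (by decide),
    Finset.sum_insert (by decide), Finset.sum_singleton, Fin.sum_univ_three, add_assoc]

theorem sum_top {M : Type*} [AddCommMonoid M] (f : Lam 4 → M) : ∑ S, f S = f top := by
  rw [univ_top, Finset.sum_singleton]

theorem shuffleSign_zero : shuffleSign zero.1 = 1 := by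
  rw [shuffleSign_eq (k := 0) _ (by decide), pow_zero]

theorem shuffleSign_e : shuffleSign e.1 = -1 := by
  rw [shuffleSign_eq (k := 1) _ (by decide), pow_one]

theorem shuffleSign_one (a : Fin 3) : shuffleSign (one a).1 = pairSign a := by
  -- A singleton passes as many elements as its position, here `0`, `2` or `3`.
  rw [shuffleSign_eq (k := ![0, 2, 3] a) _ (by revert a; decide)]
  fin_cases a <;> norm_num [pairSign]

theorem shuffleSign_eOne (a : Fin 3) : shuffleSign (eOne a).1 = pairSign a := by
  rw [shuffleSign_eq (k := ![0, 2, 3] a) _ (by revert a; decide)]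
  fin_cases a <;> norm_num [pairSign]

theorem shuffleSign_two (a : Fin 3) : shuffleSign (two a).1 = pairSign a := by
  rw [shuffleSign_eq (k := ![4, 2, 1] a) _ (by revert a; decide)]
  fin_cases a <;> norm_num [pairSign]

theorem shuffleSign_three : shuffleSign three.1 = 1 := by
  rw [shuffleSign_eq (k := 2) _ (by decide)]
  norm_num

theorem shuffleSign_eTwo (a : Fin 3) : shuffleSign (eTwo a).1 = - pairSign a := by
  rw [shuffleSign_eq (k := ![3, 1, 0] a) _ (by revert a; decide)]
  fin_cases a <;> norm_num [pairSign]

theorem shuffleSign_top : shuffleSign top.1 = 1 := by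
  rw [shuffleSign_eq (k := 0) _ (by decide), pow_zero]

theorem compl_eOne (a : Fin 3) : (eOne a).compl = two a := rfl

theorem compl_two (a : Fin 3) : (two a).compl = eOne a := by revert a; decide

theorem compl_eTwo (a : Fin 3) : (eTwo a).compl = one a := by revert a; decide

theorem compl_three : three.compl = e := by decide

theorem compl_top : top.compl = zero := by decide

theorem compl_zero : zero.compl = top := rfl

theorem compl_e : e.compl = three := rfl

theorem compl_one (a : Fin 3) : (one a).compl = eTwo a := rfl

end Lam

/-! ### The pairing of super Yang-Mills theory in components -/

theorem formPair_apply (κ : LinearMap.BilinForm ℂ 𝔤) (x y : FormIdx → Fld 𝔤) :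
    formPair κ x y = ∑ F : FormIdx, wedgeSign F • fldPair κ (x F) (y (F.1ᶜ, F.2ᶜ)) := by
  simp [formPair]

theorem formPair_one_three (κ : LinearMap.BilinForm ℂ 𝔤) (x : FormIdxOf 1 → Fld 𝔤)
    (y : FormIdxOf 3 → Fld 𝔤) : formPair κ (formExt 1 x) (formExt 3 y) =
      fldPair κ (x ⟨({0}, ∅), rfl⟩) (y ⟨({1}, {0, 1}), rfl⟩)
      - fldPair κ (x ⟨({1}, ∅), rfl⟩) (y ⟨({0}, {0, 1}), rfl⟩)
      + (fldPair κ (x ⟨(∅, {0}), rfl⟩) (y ⟨({0, 1}, {1}), rfl⟩)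
      - fldPair κ (x ⟨(∅, {1}), rfl⟩) (y ⟨({0, 1}, {0}), rfl⟩)) := by
  simp only [formPair_apply, Fintype.sum_prod_type, sum_finset_two, wedgeSign,
    compl_singleton_zero, compl_singleton_one, compl_pair, compl_empty_eq_pair, shuffleSign_empty,
    shuffleSign_singleton_zero, shuffleSign_singleton_one, shuffleSign_pair]
  simp [formExt_of_eq, formExt_of_ne]
  abel

/-- The coefficient `-2` arises because `dz₁ ∧ dz̄₁ ∧ dz₂ ∧ dz̄₂` is minus the reference form and
occurs twice in the square of `dz₁ ∧ dz̄₁ + dz₂ ∧ dz̄₂`. -/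
theorem formPair_sdIncl (κ : LinearMap.BilinForm ℂ 𝔤) (x y : SD → Fld 𝔤) :
    formPair κ (sdIncl x) (sdIncl y) = fldPair κ (x .hol) (y .anti)
      + fldPair κ (x .anti) (y .hol) - (2 : ℂ) • fldPair κ (x .kah) (y .kah) := by
  simp only [formPair_apply, Fintype.sum_prod_type, sum_finset_two, wedgeSign,
    compl_singleton_zero, compl_singleton_one, compl_pair, compl_empty_eq_pair, shuffleSign_empty,
    shuffleSign_singleton_zero, shuffleSign_singleton_one, shuffleSign_pair]
  simp [sdIncl_hol, sdIncl_anti, sdIncl_zero_zero, sdIncl_one_one, sdIncl_zero_one,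
    sdIncl_one_zero, sdIncl_of_card_ne]
  module

theorem compPair_apply (κ : LinearMap.BilinForm ℂ 𝔤) (s t : SYMIdx) (x y : SYMFields 𝔤) :
    compPair κ s t x y = fldPair κ (x s) (y t) := rfl

theorem symHalfPair_apply (κ : LinearMap.BilinForm ℂ 𝔤) (x y : SYMFields 𝔤) :
    symHalfPair κ x y =
      - fldPair κ (x (.c zero)) (y (.cSt top))
      + formPair κ (formExt 1 (pick (.A zero) x)) (formExt 3 (pick (.ASt top) y))
      + (- (fldPair κ (x (.lam e 0)) (y (.lamSt three 1))
          - fldPair κ (x (.lam e 1)) (y (.lamSt three 0)))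
        + ∑ a, pairSign a • (fldPair κ (x (.lam (one a) 0)) (y (.lamSt (eTwo a) 1))
          - fldPair κ (x (.lam (one a) 1)) (y (.lamSt (eTwo a) 0))))
      + (∑ a, pairSign a • fldPair κ (x (.phi (eOne a))) (y (.phiSt (two a)))
        + ∑ a, pairSign a • fldPair κ (x (.phi (two a))) (y (.phiSt (eOne a))))
      + ((fldPair κ (x (.chi three 0)) (y (.chiSt e 1))
          - fldPair κ (x (.chi three 1)) (y (.chiSt e 0)))
        - ∑ a, pairSign a • (fldPair κ (x (.chi (eTwo a) 0)) (y (.chiSt (one a) 1))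
          - fldPair κ (x (.chi (eTwo a) 1)) (y (.chiSt (one a) 0))))
      + formPair κ (sdIncl (pick (.B top) x)) (sdIncl (pick (.BSt zero) y)) := by
  simp only [symHalfPair, sum_zero, sum_one, sum_two, sum_three, sum_top, shuffleSign_zero,
    shuffleSign_e, shuffleSign_one, shuffleSign_eOne, shuffleSign_two, shuffleSign_three,
    shuffleSign_eTwo, shuffleSign_top, compl_eOne, compl_two, compl_eTwo, compl_three, compl_top,
    compl_zero, compl_e, compl_one, LinearMap.add_apply, LinearMap.neg_apply,
    LinearMap.sub_apply, LinearMap.smul_apply, LinearMap.sum_apply, compPair_apply,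
    LinearMap.compl₁₂_apply, LinearMap.comp_apply, one_smul, neg_smul, Finset.sum_neg_distrib,
    sub_eq_add_neg]

theorem symHalfPair_sub {κ : LinearMap.BilinForm ℂ 𝔤} (hs : κ.IsSymm) (x y : SYMFields 𝔤) :
    symHalfPair κ x y - symHalfPair κ y x =
      ∑ b, twCoeff b • fldPair κ (x (twIdx b)) (y (twIdx (twDual b))) := by
  -- Symmetry of `κ` puts `x` in the first slot of every term; both sides are then the same
  -- combination of pairings.
  simp only [symHalfPair_apply, formPair_one_three, formPair_sdIncl, Blocks.sum_eq, VecIdx.sum_eq,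
    VecStIdx.sum_eq, ScalarIdx.sum_eq, ScalarStIdx.sum_eq, Fin.sum_univ_three, twCoeff, twDual,
    twIdx, pick_apply, fldPair_symm hs (y _)]
  module

theorem twModel_pair (κ : LinearMap.BilinForm ℂ 𝔤) (x y : TwIdx → Fld 𝔤) :
    (twModel κ).pair x y = ∑ b, twCoeff b • fldPair κ (x b) (y (twDual b)) :=
  coeffPair_apply κ twCoeff twDual x y

theorem twistedSYM_pair (κ : LinearMap.BilinForm ℂ 𝔤) (x y : SYMFields 𝔤) :
    (twistedSYM κ holTwist).pair x y = symHalfPair κ x y - symHalfPair κ y x := rfl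

theorem twistedSYM_pair_eq {κ : LinearMap.BilinForm ℂ 𝔤} (hs : κ.IsSymm) (x y : SYMFields 𝔤)
    (x' y' : TwIdx → Fld 𝔤) (hx : ∀ b, x' b = x (twIdx b)) (hy : ∀ b, y' b = y (twIdx b)) :
    (twistedSYM κ holTwist).pair x y = (twModel κ).pair x' y' := by
  rw [twistedSYM_pair, symHalfPair_sub hs, twModel_pair]
  exact Finset.sum_congr rfl fun b _ => by rw [hx, hy]

/-- The components of the twisted theory correspond to those of the model. -/
def twEquiv : TwIdx ≃ SYMIdx := Equiv.ofBijective twIdx ⟨twIdx_injective, twIdx_surjective⟩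

/-- The holomorphic twist in terms of the model. -/
def twReindexing {κ : LinearMap.BilinForm ℂ 𝔤} (hs : κ.IsSymm) :
    Reindexing (twModel κ) (twistedSYM κ holTwist) where
  e := twEquiv
  deg b := twIdx_deg b
  par b := twIdx_par b
  d y b := holTwistD_twIdx y b
  pair x y := twistedSYM_pair_eq hs x y _ _ (fun _ => rfl) fun _ => rfl

end Models

end

/-! ### Transport from the models to the two theories -/

theorem mainTheorem4 {𝔤 : Type*} [LieRing 𝔤] [LieAlgebra ℂ 𝔤] [FiniteDimensional ℂ 𝔤]
    (κ : LinearMap.BilinForm ℂ 𝔤) (hsymm : κ.IsSymm) (hnondeg : κ.Nondegenerate)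
    (hinv : ∀ x y z : 𝔤, κ ⁅x, y⁆ z = κ x ⁅y, z⁆) :
    (twistedSYM κ holTwist).IsBVTheory ∧ (holBF κ).IsBVTheory ∧
      ∃ R : BVData.DeformationRetract (holBF κ) (twistedSYM κ holTwist), R.IsSymplectic :=
  let f := twReindexing hsymm
  let f₀ := bfReindexing hsymm
  ⟨f.isBVTheory (twModel_isBVTheory hsymm hnondeg),
    f₀.isBVTheory (bfModel_isBVTheory hsymm hnondeg),
    f.retract f₀ (modelRetract κ), f.isSymplectic f₀ (modelRetract_isSymplectic κ)⟩
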